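/- Let $(\Omega,\mathcal F,\{\mathcal F_t\}_{t\ge 0},P)$ be a complete filtered probability space, $T>0$, $n\ge 1$, $G\subseteq\mathbb R^n$ a domain, $p\in[1,\infty]$ and $l,s\in\mathbb R$. For a Banach space $X$, $L^p_{\mathcal F}(0,T;X)$ denotes the Banach space of (classes modulo a.e. equality of) measurable, $\{\mathcal F_t\}$-adapted $X$-valued processes on $[0,T]\times\Omega$ with finite norm in $L^p([0,T]\times\Omega,\,dt\otimes P;X)$. *Symbols.* Let $a:[0,T]\times\Omega\times G\times\mathbb R^n\to\mathbb C$ be a symbol of order $(l,\infty)$, that is: (1) $a(t,\omega,\cdot,\cdot)\in C^\infty(G\times\mathbb R^n)$ for all $(t,\omega)$; (2) $a(\cdot,\cdot,x,\xi)$ is a measurable $\{\mathcal F_t\}$-adapted process for all $(x,\xi)$; (3) for all multi-indices $\alpha,\beta$ and every compact $K\subseteq G$ there is $M_{\alpha,\beta,K}\in L^\infty_{\mathcal F}(0,T;\mathbb R)$ such that $$|\partial_\xi^\alpha\partial_x^\beta a(t,\omega,x,\xi)|\le M_{\alpha,\beta,K}(t,\omega)\,(1+|\xi|)^{l-|\alpha|}\qquad\text{for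 all }(t,\omega,x,\xi)\in[0,T]\times\Omega\times K\times\mathbb R^n .$$ *Operator.* The stochastic pseudo-differential operator $A$ with symbol $a$ is $$(Au)(t,\omega,x)=(2\pi)^{-n}\int_{\mathbb R^n}e^{ix\cdot\xi}\,a(t,\omega,x,\xi)\,\hat u(t,\omega,\xi)\,d\xi,\qquad \hat u(t,\omega,\xi)=\int_G e^{-ix\cdot\xi}u(t,\omega,x)\,dx,$$ understood in the sense of distributions on $G$: for $\varphi\in C_0^\infty(G)$, $\langle Au,\varphi\rangle=(2\pi)^{-n}\int_{\mathbb R^n}\big(\int_G e^{ix\cdot\xi}a\,\varphi\,dx\big)\hat u\,d\xi$, where the integral in $\xi$ converges absolutely. *Spaces.* $L^p_{\mathcal F}(0,T;H^s_{comp}(G))$ is the union over the compact sets $K\subseteq G$ of the Banach spaces of all $u\in L^p_{\mathcal F}(0,T;H^s(\mathbb R^n))$ with $\operatorname{supp}u(t,\omega)\subseteq K$ for almost all $(t,\omega)$, with the locally convex inductive limit topology. $L^p_{\mathcal F}(0,T;H^{r}_{loc}(G))$ is the space of (classes modulo a.e. equality of) processes $v$ with values in $H^r_{loc}(G)=\{v\in\mathcal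 D'(G): \psi v\in H^r\ \forall\psi\in C_0^\infty(G)\}$ such that, for every $\psi\in C_0^\infty(G)$, $\psi v$ is a measurable adapted $H^r(\mathbb R^n)$-valued process with $\|\psi v\|_{L^p([0,T]\times\Omega;H^r(\mathbb R^n))}<\infty$, with the topology defined by these seminorms. Then $A$ is well defined as a linear map $$A:\ L^p_{\mathcal F}(0,T;H^s_{comp}(G))\longrightarrow L^p_{\mathcal F}(0,T;H^{s-l}_{loc}(G)),$$ and it is continuous. -/

import Mathlib

open MeasureTheory Filter Topology TopologicalSpace
open scoped ENNReal NNReal ContDiff SchwartzMap Distributions FourierTransform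

noncomputable section

namespace SPDO

/-- The Euclidean space `ℝⁿ`. -/
abbrev Eu (n : ℕ) : Type := EuclideanSpace ℝ (Fin n)

/-! ### The Sobolev space `H^s(ℝⁿ)` -/

/-- The tempered distributions `u` on `ℝⁿ` with `(1 - c Δ)^{s/2} u ∈ L²(ℝⁿ)`, `c = (2π)⁻²`
(the value of the constant `c` only changes the norm into an equivalent one). -/
def sobolevSubmodule (n : ℕ) (s : ℝ) : Submodule ℂ 𝓢'(Eu n, ℂ) where
  carrier := {u | TemperedDistribution.MemSobolev s 2 u}
  add_mem' hu hv := hu.add hv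
  zero_mem' := TemperedDistribution.memSobolev_fun_zero _ _ _ _
  smul_mem' c _ hu := hu.smul c

/-- The Sobolev space `H^s(ℝⁿ)`, as a type of tempered distributions. -/
def Sob (n : ℕ) (s : ℝ) : Type := ↥(sobolevSubmodule n s)

namespace Sob

variable {n : ℕ} {s : ℝ}

instance : AddCommGroup (Sob n s) := inferInstanceAs (AddCommGroup ↥(sobolevSubmodule n s))

instance : Module ℂ (Sob n s) := inferInstanceAs (Module ℂ ↥(sobolevSubmodule n s))

/-- The inclusion of `H^s(ℝⁿ)` into the tempered distributions. -/
def toDist : Sob n s →ₗ[ℂ] 𝓢'(Eu n, ℂ) := (sobolevSubmodule n s).subtype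

theorem toDist_injective : Function.Injective (toDist : Sob n s → 𝓢'(Eu n, ℂ)) :=
  Subtype.val_injective

theorem memSobolev (u : Sob n s) : TemperedDistribution.MemSobolev s 2 (toDist u) := u.2

theorem exists_toL2 (u : Sob n s) : ∃ g : Lp ℂ 2 (volume : Measure (Eu n)),
    TemperedDistribution.besselPotential (Eu n) ℂ s (toDist u) = (g : 𝓢'(Eu n, ℂ)) := u.2

theorem l2_coe_injective {f g : Lp ℂ 2 (volume : Measure (Eu n))}
    (h : (f : 𝓢'(Eu n, ℂ)) = (g : 𝓢'(Eu n, ℂ))) : f = g := by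
  have hk := Lp.ker_toTemperedDistributionCLM_eq_bot (F := ℂ) (μ := (volume : Measure (Eu n)))
    (p := 2)
  exact LinearMap.ker_eq_bot.mp hk h

/-- The map `u ↦ (1 - c Δ)^{s/2} u` from `H^s(ℝⁿ)` to `L²(ℝⁿ)`. -/
def toL2 : Sob n s →ₗ[ℂ] Lp ℂ 2 (volume : Measure (Eu n)) where
  toFun u := (exists_toL2 u).choose
  map_add' u v := by
    apply l2_coe_injective
    rw [← (exists_toL2 (u + v)).choose_spec, ← Lp.toTemperedDistributionCLM_apply]
    simp only [map_add, Lp.toTemperedDistributionCLM_apply]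
    exact congrArg₂ (· + ·) (exists_toL2 u).choose_spec (exists_toL2 v).choose_spec
  map_smul' c u := by
    apply l2_coe_injective
    rw [← (exists_toL2 (c • u)).choose_spec, ← Lp.toTemperedDistributionCLM_apply]
    simp only [map_smul, Lp.toTemperedDistributionCLM_apply, RingHom.id_apply]
    exact congrArg (c • ·) (exists_toL2 u).choose_spec

theorem besselPotential_eq (u : Sob n s) :
    TemperedDistribution.besselPotential (Eu n) ℂ s (toDist u) = (toL2 u : 𝓢'(Eu n, ℂ)) :=
  (exists_toL2 u).choose_spec

theorem toL2_injective : Function.Injective (toL2 : Sob n s →ₗ[ℂ] _) := by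
  intro u v h
  apply toDist_injective
  have h1 : TemperedDistribution.besselPotential (Eu n) ℂ s (toDist u) =
      TemperedDistribution.besselPotential (Eu n) ℂ s (toDist v) := by
    rw [besselPotential_eq, besselPotential_eq, h]
  have h2 := (TemperedDistribution.besselPotential_neg_apply_eq_iff s _ (toDist u)).2 rfl
  rw [h1, TemperedDistribution.besselPotential_besselPotential_apply] at h2
  simpa using h2.symm

/-- The norm `‖u‖_{H^s} = ‖(1 - c Δ)^{s/2} u‖_{L²}`. -/
instance : NormedAddCommGroup (Sob n s) :=
  NormedAddCommGroup.induced (Sob n s) _ (toL2 : Sob n s →ₗ[ℂ] _) toL2_injective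

instance : NormedSpace ℂ (Sob n s) :=
  NormedSpace.induced ℂ (Sob n s) _ (toL2 : Sob n s →ₗ[ℂ] _)

end Sob

/-! ### The local Sobolev space `H^r_loc(G)` -/

/-- The product of a test function on `G` and a Schwartz function, as a test function on `G`. -/
def mulSchwartz {n : ℕ} {G : Opens (Eu n)} (ψ : 𝓓(G, ℂ)) (f : 𝓢(Eu n, ℂ)) : 𝓓(G, ℂ) where
  toFun x := ψ x * f x
  contDiff' := ψ.contDiff.mul (f.smooth ⊤)
  hasCompactSupport' := ψ.hasCompactSupport.mul_right
  tsupport_subset' := (tsupport_mul_subset_left).trans ψ.tsupport_subset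

/-- `w` is the product `ψ v` of the test function `ψ` on `G` and the distribution `v ∈ 𝓓'(G)`,
extended by zero to `ℝⁿ`. -/
def IsCutoff {n : ℕ} {G : Opens (Eu n)} (ψ : 𝓓(G, ℂ)) (v : 𝓓(G, ℂ) →L[ℂ] ℂ)
    (w : 𝓢'(Eu n, ℂ)) : Prop :=
  ∀ f : 𝓢(Eu n, ℂ), w f = v (mulSchwartz ψ f)

/-- The distributions `v ∈ 𝓓'(G)` such that `ψ v ∈ H^r` for all `ψ ∈ C_0^∞(G)`. -/
def hLocSubmodule (n : ℕ) (r : ℝ) (G : Opens (Eu n)) : Submodule ℂ (𝓓(G, ℂ) →L[ℂ] ℂ) where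
  carrier := {v | ∀ ψ : 𝓓(G, ℂ), ∃ w : Sob n r, IsCutoff ψ v (Sob.toDist w)}
  add_mem' := by
    intro v v' hv hv' ψ
    obtain ⟨w, hw⟩ := hv ψ
    obtain ⟨w', hw'⟩ := hv' ψ
    refine ⟨w + w', fun f => ?_⟩
    rw [map_add]
    exact congrArg₂ (· + ·) (hw f) (hw' f)
  zero_mem' := by
    intro ψ
    refine ⟨0, fun f => ?_⟩
    rw [map_zero]
    rfl
  smul_mem' := by
    intro c v hv ψ
    obtain ⟨w, hw⟩ := hv ψ
    refine ⟨c • w, fun f => ?_⟩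
    rw [map_smul]
    exact congrArg (c • ·) (hw f)

/-- The local Sobolev space `H^r_loc(G)`, as a type of distributions on `G`. -/
def HLoc (n : ℕ) (r : ℝ) (G : Opens (Eu n)) : Type := ↥(hLocSubmodule n r G)

namespace HLoc

variable {n : ℕ} {r : ℝ} {G : Opens (Eu n)}

instance : AddCommGroup (HLoc n r G) := inferInstanceAs (AddCommGroup ↥(hLocSubmodule n r G))

instance : Module ℂ (HLoc n r G) := inferInstanceAs (Module ℂ ↥(hLocSubmodule n r G))

/-- The inclusion of `H^r_loc(G)` into `𝓓'(G)`. -/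
def toDist : HLoc n r G →ₗ[ℂ] (𝓓(G, ℂ) →L[ℂ] ℂ) := (hLocSubmodule n r G).subtype

theorem exists_isCutoff (ψ : 𝓓(G, ℂ)) (v : HLoc n r G) :
    ∃ w : Sob n r, IsCutoff ψ (toDist v) (Sob.toDist w) := v.2 ψ

theorem isCutoff_unique {ψ : 𝓓(G, ℂ)} {v : 𝓓(G, ℂ) →L[ℂ] ℂ} {w w' : Sob n r}
    (hw : IsCutoff ψ v (Sob.toDist w)) (hw' : IsCutoff ψ v (Sob.toDist w')) : w = w' := by
  apply Sob.toDist_injective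
  ext f
  exact (hw f).trans (hw' f).symm

/-- The map `v ↦ ψ v` from `H^r_loc(G)` to `H^r(ℝⁿ)`, for `ψ ∈ C_0^∞(G)`. -/
def cut (ψ : 𝓓(G, ℂ)) : HLoc n r G →ₗ[ℂ] Sob n r where
  toFun v := (exists_isCutoff ψ v).choose
  map_add' v v' := by
    refine isCutoff_unique (exists_isCutoff ψ (v + v')).choose_spec fun f => ?_
    rw [map_add, map_add]
    exact congrArg₂ (· + ·) ((exists_isCutoff ψ v).choose_spec f)
      ((exists_isCutoff ψ v').choose_spec f)
  map_smul' c v := by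
    refine isCutoff_unique (exists_isCutoff ψ (c • v)).choose_spec fun f => ?_
    rw [RingHom.id_apply, map_smul, map_smul]
    exact congrArg (c • ·) ((exists_isCutoff ψ v).choose_spec f)

theorem isCutoff_cut (ψ : 𝓓(G, ℂ)) (v : HLoc n r G) :
    IsCutoff ψ (toDist v) (Sob.toDist (cut ψ v)) := (exists_isCutoff ψ v).choose_spec

end HLoc

/-! ### Adapted processes on `[0, T]` -/

section Processes

variable {Ω : Type*} {mΩ : MeasurableSpace Ω}

/-- The measure `dt ⊗ P` on `[0, T] × Ω`. -/
abbrev timeMeasure (T : ℝ) (P : Measure Ω) : Measure (Set.Icc (0 : ℝ) T × Ω) :=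
  ((volume : Measure ℝ).comap (Subtype.val : Set.Icc (0 : ℝ) T → ℝ)).prod P

/-- `u` is a (strongly) measurable process on `[0, T] × Ω` that is adapted to the filtration. -/
def IsAdaptedProcess {X : Type*} [TopologicalSpace X] (ℱ : Filtration ℝ≥0 mΩ) {T : ℝ}
    (u : Set.Icc (0 : ℝ) T × Ω → X) : Prop :=
  StronglyMeasurable u ∧
    ∀ t : Set.Icc (0 : ℝ) T, StronglyMeasurable[ℱ ⟨t.1, t.2.1⟩] fun w => u (t, w)

theorem IsAdaptedProcess.add {X : Type*} [NormedAddCommGroup X] {ℱ : Filtration ℝ≥0 mΩ} {T : ℝ}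
    {u v : Set.Icc (0 : ℝ) T × Ω → X} (hu : IsAdaptedProcess ℱ u) (hv : IsAdaptedProcess ℱ v) :
    IsAdaptedProcess ℱ (u + v) :=
  ⟨hu.1.add hv.1, fun t => (hu.2 t).add (hv.2 t)⟩

theorem IsAdaptedProcess.smul {X : Type*} [NormedAddCommGroup X] [NormedSpace ℂ X]
    {ℱ : Filtration ℝ≥0 mΩ} {T : ℝ} {u : Set.Icc (0 : ℝ) T × Ω → X} (c : ℂ)
    (hu : IsAdaptedProcess ℱ u) : IsAdaptedProcess ℱ (c • u) :=
  ⟨hu.1.const_smul c, fun t => (hu.2 t).const_smul c⟩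

theorem IsAdaptedProcess.zero {X : Type*} [NormedAddCommGroup X] (ℱ : Filtration ℝ≥0 mΩ) {T : ℝ} :
    IsAdaptedProcess ℱ (0 : Set.Icc (0 : ℝ) T × Ω → X) :=
  ⟨stronglyMeasurable_zero, fun _ => stronglyMeasurable_zero⟩

/-- `L^p_𝓕(0, T; X)` for a Banach space `X`: the classes in `L^p([0, T] × Ω; X)` of measurable
adapted processes. -/
def LpF (X : Type*) [NormedAddCommGroup X] [NormedSpace ℂ X] (ℱ : Filtration ℝ≥0 mΩ)
    (P : Measure Ω) (T : ℝ) (p : ℝ≥0∞) : Submodule ℂ (Lp X p (timeMeasure T P)) where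
  carrier := {u | ∃ u₀ : Set.Icc (0 : ℝ) T × Ω → X,
    IsAdaptedProcess ℱ u₀ ∧ u =ᵐ[timeMeasure T P] u₀}
  add_mem' := by
    rintro u v ⟨u₀, hu, hu'⟩ ⟨v₀, hv, hv'⟩
    exact ⟨u₀ + v₀, hu.add hv, (Lp.coeFn_add u v).trans (hu'.add hv')⟩
  zero_mem' := ⟨0, IsAdaptedProcess.zero ℱ, Lp.coeFn_zero _ _ _⟩
  smul_mem' := by
    rintro c u ⟨u₀, hu, hu'⟩
    exact ⟨c • u₀, hu.smul c, (Lp.coeFn_smul c u).trans (hu'.const_smul c)⟩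

/-! ### The space `L^p_𝓕(0, T; H^s_comp(G))` -/

/-- The elements of `L^p_𝓕(0, T; H^s(ℝⁿ))` with (distributional) support in the set `K`. -/
def LpSupp (n : ℕ) (s : ℝ) (K : Set (Eu n)) (ℱ : Filtration ℝ≥0 mΩ) (P : Measure Ω) (T : ℝ)
    (p : ℝ≥0∞) : Submodule ℂ (Lp (Sob n s) p (timeMeasure T P)) where
  carrier := {u | u ∈ LpF (Sob n s) ℱ P T p ∧
    ∀ᵐ z ∂timeMeasure T P, Distribution.IsVanishingOn (Sob.toDist (u z)) Kᶜ}
  add_mem' := by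
    rintro u v ⟨hu, hu'⟩ ⟨hv, hv'⟩
    refine ⟨add_mem hu hv, ?_⟩
    filter_upwards [hu', hv', Lp.coeFn_add u v] with z h1 h2 h3 f hf
    rw [h3, Pi.add_apply, map_add]
    exact (congrArg₂ (· + ·) (h1 f hf) (h2 f hf)).trans (add_zero 0)
  zero_mem' := by
    refine ⟨zero_mem _, ?_⟩
    filter_upwards [Lp.coeFn_zero (Sob n s) p (timeMeasure T P)] with z h3 f hf
    rw [h3, Pi.zero_apply, map_zero]
    rfl
  smul_mem' := by
    rintro c u ⟨hu, hu'⟩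
    refine ⟨Submodule.smul_mem _ c hu, ?_⟩
    filter_upwards [hu', Lp.coeFn_smul c u] with z h1 h3 f hf
    rw [h3, Pi.smul_apply, map_smul]
    exact (congrArg (c • ·) (h1 f hf)).trans (smul_zero c)

theorem LpSupp_mono {n : ℕ} {s : ℝ} {K K' : Set (Eu n)} (h : K ⊆ K') (ℱ : Filtration ℝ≥0 mΩ)
    (P : Measure Ω) (T : ℝ) (p : ℝ≥0∞) : LpSupp n s K ℱ P T p ≤ LpSupp n s K' ℱ P T p := by
  rintro u ⟨hu, hu'⟩
  refine ⟨hu, ?_⟩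
  filter_upwards [hu'] with z hz
  exact hz.mono (Set.compl_subset_compl.2 h)

/-- The union of the spaces `L^p_𝓕(0, T; H^s_K)` over the compact sets `K ⊆ G`. -/
def lpCompSubmodule (n : ℕ) (s : ℝ) (G : Opens (Eu n)) (ℱ : Filtration ℝ≥0 mΩ) (P : Measure Ω)
    (T : ℝ) (p : ℝ≥0∞) : Submodule ℂ (Lp (Sob n s) p (timeMeasure T P)) where
  carrier := {u | ∃ K : Set (Eu n), IsCompact K ∧ K ⊆ G ∧ u ∈ LpSupp n s K ℱ P T p}
  add_mem' := by
    rintro u v ⟨K, hK, hKG, hu⟩ ⟨K', hK', hKG', hv⟩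
    exact ⟨K ∪ K', hK.union hK', Set.union_subset hKG hKG',
      add_mem (LpSupp_mono Set.subset_union_left _ _ _ _ hu)
        (LpSupp_mono Set.subset_union_right _ _ _ _ hv)⟩
  zero_mem' := ⟨∅, isCompact_empty, Set.empty_subset _, zero_mem _⟩
  smul_mem' := by
    rintro c u ⟨K, hK, hKG, hu⟩
    exact ⟨K, hK, hKG, Submodule.smul_mem _ c hu⟩

/-- `L^p_𝓕(0, T; H^s_comp(G))`, the inductive limit of the Banach spaces `L^p_𝓕(0, T; H^s_K)`,
`K ⊆ G` compact. -/
def LpComp (n : ℕ) (s : ℝ) (G : Opens (Eu n)) (ℱ : Filtration ℝ≥0 mΩ) (P : Measure Ω)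
    (T : ℝ) (p : ℝ≥0∞) : Type _ := ↥(lpCompSubmodule n s G ℱ P T p)

namespace LpComp

variable {n : ℕ} {s : ℝ} {G : Opens (Eu n)} {ℱ : Filtration ℝ≥0 mΩ} {P : Measure Ω}
  {T : ℝ} {p : ℝ≥0∞}

instance : AddCommGroup (LpComp n s G ℱ P T p) :=
  inferInstanceAs (AddCommGroup ↥(lpCompSubmodule n s G ℱ P T p))

instance : Module ℂ (LpComp n s G ℱ P T p) :=
  inferInstanceAs (Module ℂ ↥(lpCompSubmodule n s G ℱ P T p))

/-- The class in `L^p([0, T] × Ω; H^s(ℝⁿ))` underlying an element. -/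
def toLp : LpComp n s G ℱ P T p →ₗ[ℂ] Lp (Sob n s) p (timeMeasure T P) :=
  (lpCompSubmodule n s G ℱ P T p).subtype

/-- The inclusion of `L^p_𝓕(0, T; H^s_K)` for a compact set `K ⊆ G`. -/
def incl (K : Set (Eu n)) (hK : IsCompact K) (hKG : K ⊆ G) :
    ↥(LpSupp n s K ℱ P T p) →ₗ[ℂ] LpComp n s G ℱ P T p :=
  Submodule.inclusion (show LpSupp n s K ℱ P T p ≤ lpCompSubmodule n s G ℱ P T p from
    fun _ hu => ⟨K, hK, hKG, hu⟩)

/-- The inductive limit topology: the finest locally convex vector space topology for which all the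
inclusions of the Banach spaces `L^p_𝓕(0, T; H^s_K)` are continuous. -/
instance [Fact (1 ≤ p)] : TopologicalSpace (LpComp n s G ℱ P T p) :=
  sInf {τ : TopologicalSpace (LpComp n s G ℱ P T p) |
    @IsTopologicalAddGroup (LpComp n s G ℱ P T p) τ _ ∧
    @ContinuousSMul ℂ (LpComp n s G ℱ P T p) _ _ τ ∧
    @LocallyConvexSpace ℝ (LpComp n s G ℱ P T p) _ _ _ _ τ ∧
    ∀ (K : Set (Eu n)) (hK : IsCompact K) (hKG : K ⊆ G),
      @Continuous _ _ _ τ (incl K hK hKG : ↥(LpSupp n s K ℱ P T p) → LpComp n s G ℱ P T p)}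

end LpComp

/-! ### The space `L^p_𝓕(0, T; H^r_loc(G))` -/

/-- A process `v` with values in `H^r_loc(G)` such that `ψ v` is a measurable adapted process with
finite `L^p([0, T] × Ω; H^r)`-norm for all `ψ ∈ C_0^∞(G)`. -/
def IsLocProcess {n : ℕ} {r : ℝ} {G : Opens (Eu n)} (ℱ : Filtration ℝ≥0 mΩ) (P : Measure Ω)
    {T : ℝ} (p : ℝ≥0∞) (v : Set.Icc (0 : ℝ) T × Ω → HLoc n r G) : Prop :=
  ∀ ψ : 𝓓(G, ℂ), IsAdaptedProcess ℱ (fun z => HLoc.cut ψ (v z)) ∧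
    MemLp (fun z => HLoc.cut ψ (v z)) p (timeMeasure T P)

/-- The vector space of these processes. -/
def locProcesses (n : ℕ) (r : ℝ) (G : Opens (Eu n)) (ℱ : Filtration ℝ≥0 mΩ) (P : Measure Ω)
    (T : ℝ) (p : ℝ≥0∞) : Submodule ℂ (Set.Icc (0 : ℝ) T × Ω → HLoc n r G) where
  carrier := {v | IsLocProcess ℱ P p v}
  add_mem' := by
    intro v v' hv hv' ψ
    simp only [Pi.add_apply, map_add]
    exact ⟨(hv ψ).1.add (hv' ψ).1, (hv ψ).2.add (hv' ψ).2⟩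
  zero_mem' := by
    intro ψ
    simp only [Pi.zero_apply, map_zero]
    exact ⟨IsAdaptedProcess.zero ℱ, MemLp.zero⟩
  smul_mem' := by
    intro c v hv ψ
    simp only [Pi.smul_apply, map_smul]
    exact ⟨(hv ψ).1.smul c, (hv ψ).2.const_smul c⟩

/-- The processes that vanish almost everywhere. -/
def nullProcesses (n : ℕ) (r : ℝ) (G : Opens (Eu n)) (ℱ : Filtration ℝ≥0 mΩ) (P : Measure Ω)
    (T : ℝ) (p : ℝ≥0∞) : Submodule ℂ ↥(locProcesses n r G ℱ P T p) where
  carrier := {v | ∀ᵐ z ∂timeMeasure T P, v.1 z = 0}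
  add_mem' := by
    intro v v' (hv : ∀ᵐ z ∂timeMeasure T P, v.1 z = 0) (hv' : ∀ᵐ z ∂timeMeasure T P, v'.1 z = 0)
    change ∀ᵐ z ∂timeMeasure T P, (v + v').1 z = 0
    filter_upwards [hv, hv'] with z h h'
    exact (congrArg₂ (· + ·) h h').trans (add_zero 0)
  zero_mem' := by
    change ∀ᵐ z ∂timeMeasure T P, (0 : ↥(locProcesses n r G ℱ P T p)).1 z = 0
    exact Eventually.of_forall fun _ => rfl
  smul_mem' := by
    intro c v (hv : ∀ᵐ z ∂timeMeasure T P, v.1 z = 0)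
    change ∀ᵐ z ∂timeMeasure T P, (c • v).1 z = 0
    filter_upwards [hv] with z h
    exact (congrArg (c • ·) h).trans (smul_zero c)

/-- `L^p_𝓕(0, T; H^r_loc(G))`: the above processes modulo equality almost everywhere. -/
def LpLoc (n : ℕ) (r : ℝ) (G : Opens (Eu n)) (ℱ : Filtration ℝ≥0 mΩ) (P : Measure Ω)
    (T : ℝ) (p : ℝ≥0∞) : Type _ := ↥(locProcesses n r G ℱ P T p) ⧸ nullProcesses n r G ℱ P T p

namespace LpLoc

variable {n : ℕ} {r : ℝ} {G : Opens (Eu n)} {ℱ : Filtration ℝ≥0 mΩ} {P : Measure Ω}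
  {T : ℝ} {p : ℝ≥0∞}

instance : AddCommGroup (LpLoc n r G ℱ P T p) :=
  inferInstanceAs (AddCommGroup (_ ⧸ nullProcesses n r G ℱ P T p))

instance : Module ℂ (LpLoc n r G ℱ P T p) :=
  inferInstanceAs (Module ℂ (_ ⧸ nullProcesses n r G ℱ P T p))

/-- The class of a process. -/
def mk : ↥(locProcesses n r G ℱ P T p) →ₗ[ℂ] LpLoc n r G ℱ P T p :=
  (nullProcesses n r G ℱ P T p).mkQ

/-- The class of `ψ v` in `L^p([0, T] × Ω; H^r(ℝⁿ))` for a process `v`. -/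
def cutProcess (ψ : 𝓓(G, ℂ)) :
    ↥(locProcesses n r G ℱ P T p) →ₗ[ℂ] Lp (Sob n r) p (timeMeasure T P) where
  toFun v := (v.2 ψ).2.toLp _
  map_add' v v' := by
    rw [← MemLp.toLp_add]
    exact MemLp.toLp_congr _ _ (Eventually.of_forall fun z =>
      map_add (HLoc.cut ψ) (v.1 z) (v'.1 z))
  map_smul' c v := by
    rw [RingHom.id_apply, ← MemLp.toLp_const_smul]
    exact MemLp.toLp_congr _ _ (Eventually.of_forall fun z =>
      map_smul (HLoc.cut ψ) c (v.1 z))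

/-- The map `v ↦ ψ v` from `L^p_𝓕(0, T; H^r_loc(G))` to `L^p([0, T] × Ω; H^r(ℝⁿ))`. -/
def cut (ψ : 𝓓(G, ℂ)) : LpLoc n r G ℱ P T p →ₗ[ℂ] Lp (Sob n r) p (timeMeasure T P) :=
  (nullProcesses n r G ℱ P T p).liftQ (cutProcess ψ) fun v hv => by
    refine LinearMap.mem_ker.2 ((MemLp.toLp_eq_toLp_iff (v.2 ψ).2 MemLp.zero).2 ?_)
    have hv' : ∀ᵐ z ∂timeMeasure T P, v.1 z = 0 := hv
    filter_upwards [hv'] with z hz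
    rw [hz, map_zero, Pi.zero_apply]

/-- The locally convex topology defined by the seminorms `v ↦ ‖ψ v‖_{L^p([0, T] × Ω; H^r)}`,
`ψ ∈ C_0^∞(G)`. -/
instance [Fact (1 ≤ p)] : TopologicalSpace (LpLoc n r G ℱ P T p) :=
  ⨅ ψ : 𝓓(G, ℂ), TopologicalSpace.induced
    (cut ψ : LpLoc n r G ℱ P T p → Lp (Sob n r) p (timeMeasure T P)) inferInstance

end LpLoc

/-! ### Symbols and stochastic pseudo-differential operators -/

/-- The symbol class `S^l_p(G × ℝⁿ)`. The norm of the iterated Fréchet derivative in the estimate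
controls all the partial derivatives `∂_ξ^α ∂_x^β a` with `|α| = k` and `|β| = j`. -/
structure IsSymbol {n : ℕ} (G : Opens (Eu n)) (ℱ : Filtration ℝ≥0 mΩ) (P : Measure Ω) {T : ℝ}
    (l : ℝ) (p : ℝ≥0∞) (a : Set.Icc (0 : ℝ) T × Ω → Eu n → Eu n → ℂ) : Prop where
  smooth : ∀ z, ContDiffOn ℝ ∞ (fun y : Eu n × Eu n => a z y.1 y.2) ((G : Set (Eu n)) ×ˢ Set.univ)
  adapted : ∀ x ∈ G, ∀ ξ, IsAdaptedProcess ℱ (fun z => a z x ξ)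
  bound : ∀ (k j : ℕ) (K : Set (Eu n)), IsCompact K → K ⊆ G →
    ∃ M : Set.Icc (0 : ℝ) T × Ω → ℝ, IsAdaptedProcess ℱ M ∧ MemLp M p (timeMeasure T P) ∧
      ∀ z, ∀ x ∈ K, ∀ ξ,
        ‖iteratedFDeriv ℝ k (fun ζ => iteratedFDeriv ℝ j (fun y => a z y ζ) x) ξ‖ ≤
          M z * (1 + ‖ξ‖) ^ (l - k)

/-- The function `h` is the Fourier transform `û(ξ) = ∫ e^{-i x·ξ} u(x) dx` of the tempered
distribution `u`. Since Mathlib's Fourier transform has the kernel `e^{-2πi x·η}`, it is represented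
by the function `η ↦ h(2πη)`. -/
def IsFourierTransform {n : ℕ} (u : 𝓢'(Eu n, ℂ)) (h : Eu n → ℂ) : Prop :=
  LocallyIntegrable h ∧ ∀ f : 𝓢(Eu n, ℂ),
    Integrable (fun η => f η * h ((2 * Real.pi) • η)) ∧ 𝓕 u f = ∫ η, f η * h ((2 * Real.pi) • η)

/-- The distribution `v ∈ 𝓓'(G)` is `(2π)^{-n} ∫ e^{i x·ξ} b(x, ξ) û(ξ) dξ`. For a distribution `u`
the integral is in general not absolutely convergent for fixed `x`; as usual it is understood in the
sense of distributions, that is, after testing with `φ(x) dx`. -/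
def IsPDOValue {n : ℕ} (G : Opens (Eu n)) (b : Eu n → Eu n → ℂ) (u : 𝓢'(Eu n, ℂ))
    (v : 𝓓(G, ℂ) →L[ℂ] ℂ) : Prop :=
  ∃ h : Eu n → ℂ, IsFourierTransform u h ∧ ∀ φ : 𝓓(G, ℂ),
    Integrable (fun ξ => (∫ x, Complex.exp (Complex.I * (inner ℝ x ξ : ℝ)) * b x ξ * φ x) * h ξ) ∧
    v φ = ((2 * Real.pi : ℝ) : ℂ) ^ (-(n : ℤ)) *
      ∫ ξ, (∫ x, Complex.exp (Complex.I * (inner ℝ x ξ : ℝ)) * b x ξ * φ x) * h ξ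

/-- The map `A : L^p_𝓕(0, T; H^s_comp(G)) → L^p_𝓕(0, T; H^r_loc(G))` is the stochastic
pseudo-differential operator with symbol `a`, that is,
`(Au)(t, ω, x) = (2π)^{-n} ∫ e^{i x·ξ} a(t, ω, x, ξ) û(t, ω, ξ) dξ`. -/
def IsSPDO {n : ℕ} {s r : ℝ} {G : Opens (Eu n)} {ℱ : Filtration ℝ≥0 mΩ} {P : Measure Ω} {T : ℝ}
    {p : ℝ≥0∞} (a : Set.Icc (0 : ℝ) T × Ω → Eu n → Eu n → ℂ)
    (A : LpComp n s G ℱ P T p → LpLoc n r G ℱ P T p) : Prop :=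
  ∀ u : LpComp n s G ℱ P T p, ∃ v : locProcesses n r G ℱ P T p, A u = LpLoc.mk v ∧
    ∀ᵐ z ∂timeMeasure T P, IsPDOValue G (a z) (Sob.toDist (LpComp.toLp u z)) (HLoc.toDist (v.1 z))

end Processes

end SPDO

end

/-!
Why stochastic pseudo-differential operators are continuous from `H^s_comp` to `H^{s-l}_loc`.

Everything is done on the Fourier side. The map `u ↦ (1 + |η|²)^{s/2} 𝓕 u` is an isometry of `H^s`
onto `L²` (`spectral`). For a fixed `z = (t, ω)` and a test function `ψ` on `G`, the operator
`u ↦ ψ a(z, x, D) u` becomes the integral operator on `L²` with kernel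
`(1 + |ζ|²)^{(s-l)/2} 𝓕[a(z, ·, 2πη) ψ](ζ - η) (1 + |η|²)^{-s/2}` (`cutKernel`). Since
`a(z, ·, 2πη) ψ` is smooth with compact support, integration by parts makes its Fourier transform
decay faster than any power, with constants proportional to a seminorm `M(z)` of the symbol
(`norm_ampFourier_le`). Peetre's inequality then bounds the kernel by
`C M(z) (1 + |ζ - η|)^{-(n+1)}` (`norm_cutKernel_le`), which is an integrable convolution kernel, so
the operator is bounded on `L²` with norm at most `C' M(z)` (`exists_kernelOp`). Neither the
derivatives in `ξ` of the symbol nor the compact support of `u` are needed for this. The same kernel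
bound at `ζ = 0` shows that `φ ↦ ⟨Au, φ⟩` is a distribution on `G` (`pdoDist`), and Fubini's theorem
identifies its product with `ψ` with the image of the integral operator (`isCutoff_pdoDist`).

For the dependence on `z`, the matrix coefficients of the integral operator are integrals of jointly
measurable functions, so the operators are weakly, hence strongly measurable in `z`
(`stronglyMeasurable_cut_pdoLoc`). Applied on `[0, T] × Ω`, and for fixed `t` on `(Ω, 𝓕_t)`, this
shows that an adapted representative of `u` is mapped to an adapted process. As `M` is essentially
bounded, `‖ψ A u‖ ≤ C ‖u‖` in `L^p` for every `ψ`, and this is continuity for the inductive limit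
topology on the left and the topology of the seminorms on the right (`continuous_spdo`).
-/

open MeasureTheory Filter Topology TopologicalSpace
open scoped ENNReal NNReal ContDiff SchwartzMap Distributions FourierTransform

noncomputable section

namespace SPDO

/-! ### Integral operators on `L²` dominated by a convolution kernel -/

section Schur

variable {n : ℕ}

/-- The complex Hilbert space `L²(ℝⁿ)`. -/
abbrev L2 (n : ℕ) : Type := Lp ℂ 2 (volume : Measure (Eu n))

/-- The Cauchy-Schwarz inequality, with one factor translated. -/
theorem lintegral_mul_translate_le (f g : L2 n) (τ : Eu n) :
    ∫⁻ η, ‖g (τ + η)‖ₑ * ‖f η‖ₑ ≤ ‖g‖ₑ * ‖f‖ₑ := by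
  have hg : Measurable fun η => g (τ + η) :=
    (Lp.stronglyMeasurable g).measurable.comp (measurable_const_add τ)
  have hf : Measurable f := (Lp.stronglyMeasurable f).measurable
  have h := ENNReal.lintegral_mul_le_Lp_mul_Lq (volume : Measure (Eu n))
    (p := 2) (q := 2) Real.HolderConjugate.two_two hg.enorm.aemeasurable hf.enorm.aemeasurable
  have h2 : ∀ u : L2 n, (∫⁻ a, ‖u a‖ₑ ^ (2 : ℝ)) ^ (1 / (2 : ℝ)) = ‖u‖ₑ := by
    intro u
    rw [Lp.enorm_def, eLpNorm_eq_lintegral_rpow_enorm_toReal (by simp) (by simp)]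
    simp
  have h3 : ∫⁻ a, ‖g (τ + a)‖ₑ ^ (2 : ℝ) = ∫⁻ a, ‖g a‖ₑ ^ (2 : ℝ) :=
    lintegral_add_left_eq_self (fun a => ‖g a‖ₑ ^ (2 : ℝ)) τ
  simp only [Pi.mul_apply, h3, h2] at h
  exact h

/-- Young's inequality in its bilinear form, for a kernel dominated by `κ(ζ - η)`. -/
theorem lintegral_kernel_le {κ : Eu n → ℝ} (hκ : Measurable κ) {k : Eu n × Eu n → ℂ}
    (hk : ∀ p, ‖k p‖ ≤ κ (p.1 - p.2)) (f g : L2 n) :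
    ∫⁻ p : Eu n × Eu n, ‖k p‖ₑ * (‖g p.1‖ₑ * ‖f p.2‖ₑ) ≤
      (∫⁻ τ, ENNReal.ofReal (κ τ)) * (‖g‖ₑ * ‖f‖ₑ) := by
  have hg : Measurable g := (Lp.stronglyMeasurable g).measurable
  have hf : Measurable f := (Lp.stronglyMeasurable f).measurable
  calc ∫⁻ p : Eu n × Eu n, ‖k p‖ₑ * (‖g p.1‖ₑ * ‖f p.2‖ₑ)
      ≤ ∫⁻ p : Eu n × Eu n, ENNReal.ofReal (κ (p.1 - p.2)) * (‖g p.1‖ₑ * ‖f p.2‖ₑ) := by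
        refine lintegral_mono fun p => ?_
        gcongr
        rw [← ofReal_norm]
        exact ENNReal.ofReal_le_ofReal (hk p)
    _ = ∫⁻ η, ∫⁻ ζ, ENNReal.ofReal (κ (ζ - η)) * (‖g ζ‖ₑ * ‖f η‖ₑ) := by
        rw [Measure.volume_eq_prod, lintegral_prod_symm _ (by fun_prop)]
    _ = ∫⁻ η, ∫⁻ τ, ENNReal.ofReal (κ τ) * (‖g (τ + η)‖ₑ * ‖f η‖ₑ) := by
        refine lintegral_congr fun η => ?_
        rw [← lintegral_add_right_eq_self _ η]
        simp
    _ = ∫⁻ τ, ∫⁻ η, ENNReal.ofReal (κ τ) * (‖g (τ + η)‖ₑ * ‖f η‖ₑ) := by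
        rw [lintegral_lintegral_swap]
        fun_prop
    _ ≤ ∫⁻ τ, ENNReal.ofReal (κ τ) * (‖g‖ₑ * ‖f‖ₑ) := by
        refine lintegral_mono fun τ => ?_
        rw [lintegral_const_mul _ (by fun_prop)]
        gcongr
        exact lintegral_mul_translate_le f g τ
    _ = _ := lintegral_mul_const _ (by fun_prop)

theorem integrable_kernel {κ : Eu n → ℝ} (hκ : Measurable κ) (hκi : Integrable κ)
    {k : Eu n × Eu n → ℂ} (hkm : Measurable k)
    (hk : ∀ p, ‖k p‖ ≤ κ (p.1 - p.2)) (f g : L2 n) :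
    Integrable (fun p : Eu n × Eu n => k p * (g p.1 * f p.2)) := by
  have hg : Measurable g := (Lp.stronglyMeasurable g).measurable
  have hf : Measurable f := (Lp.stronglyMeasurable f).measurable
  refine ⟨(by fun_prop : Measurable _).aestronglyMeasurable, ?_⟩
  rw [hasFiniteIntegral_iff_enorm]
  simp only [enorm_mul]
  refine (lintegral_kernel_le hκ hk f g).trans_lt ?_
  exact ENNReal.mul_lt_top hκi.lintegral_lt_top
    (ENNReal.mul_lt_top enorm_lt_top enorm_lt_top)

theorem norm_integral_kernel_le {κ : Eu n → ℝ} (hκ : Measurable κ) (hκi : Integrable κ)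
    {k : Eu n × Eu n → ℂ} (hk : ∀ p, ‖k p‖ ≤ κ (p.1 - p.2)) (f g : L2 n) (h : Eu n × Eu n → ℂ)
    (hh : ∀ p, ‖h p‖ = ‖k p‖ * (‖g p.1‖ * ‖f p.2‖)) :
    ‖∫ p, h p‖ ≤ (∫ τ, κ τ) * (‖g‖ * ‖f‖) := by
  have hκ0 : ∀ τ, 0 ≤ κ τ := fun τ => (norm_nonneg _).trans ((hk (τ, 0)).trans_eq (by simp))
  have h1 : ‖∫ p, h p‖ₑ ≤ (∫⁻ τ, ENNReal.ofReal (κ τ)) * (‖g‖ₑ * ‖f‖ₑ) := by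
    refine (enorm_integral_le_lintegral_enorm _).trans
      (le_trans (le_of_eq (lintegral_congr fun p => ?_)) (lintegral_kernel_le hκ hk f g))
    rw [← ofReal_norm, hh, ENNReal.ofReal_mul (norm_nonneg _),
      ENNReal.ofReal_mul (norm_nonneg _)]
    simp only [ofReal_norm]
  rw [← ofReal_integral_eq_lintegral_ofReal hκi (Eventually.of_forall hκ0)] at h1
  simp only [← ofReal_norm] at h1
  rw [← ENNReal.ofReal_mul (norm_nonneg _), ← ENNReal.ofReal_mul (integral_nonneg hκ0)] at h1
  exact (ENNReal.ofReal_le_ofReal_iff (mul_nonneg (integral_nonneg hκ0) (by positivity))).1 h1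

/-- A kernel dominated by `κ(ζ - η)` with `κ ∈ L¹` is the kernel of a bounded operator on `L²`.
The operator is obtained from its sesquilinear form by the Riesz representation theorem. -/
theorem exists_kernelOp {κ : Eu n → ℝ} (hκ : Measurable κ) (hκi : Integrable κ)
    {k : Eu n × Eu n → ℂ} (hkm : Measurable k) (hk : ∀ p, ‖k p‖ ≤ κ (p.1 - p.2)) :
    ∃ S : L2 n →L[ℂ] L2 n, (∀ f, ‖S f‖ ≤ (∫ τ, κ τ) * ‖f‖) ∧
      ∀ f g : L2 n, inner ℂ g (S f) =
        ∫ p : Eu n × Eu n, k p * (starRingEnd ℂ (g p.1) * f p.2) := by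
  have κ0 : ∀ τ, 0 ≤ κ τ := fun τ => (norm_nonneg _).trans ((hk (τ, 0)).trans_eq (by simp))
  let B : L2 n → L2 n → ℂ := fun f g =>
    ∫ p : Eu n × Eu n, starRingEnd ℂ (k p) * (g p.1 * starRingEnd ℂ (f p.2))
  have hBi : ∀ f g : L2 n, Integrable
      (fun p : Eu n × Eu n => starRingEnd ℂ (k p) * (g p.1 * starRingEnd ℂ (f p.2))) := by
    intro f g
    have hg : Measurable g := (Lp.stronglyMeasurable g).measurable
    have hf : Measurable f := (Lp.stronglyMeasurable f).measurable
    refine (integrable_kernel hκ hκi hkm hk f g).congr' ?_ (Eventually.of_forall fun p => ?_)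
    · have : Measurable (starRingEnd ℂ) := Complex.continuous_conj.measurable
      exact (by fun_prop : Measurable _).aestronglyMeasurable
    · simp
  have hB1 : ∀ f f' g, B (f + f') g = B f g + B f' g := by
    intro f f' g
    rw [← integral_add (hBi _ _) (hBi _ _)]
    refine integral_congr_ae ?_
    have := (Measure.quasiMeasurePreserving_snd (μ := (volume : Measure (Eu n)))
      (ν := (volume : Measure (Eu n)))).ae (Lp.coeFn_add f f')
    filter_upwards [this] with p hp
    rw [hp, Pi.add_apply, map_add]; ring
  have hB2 : ∀ (c : ℂ) f g, B (c • f) g = starRingEnd ℂ c • B f g := by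
    intro c f g
    rw [smul_eq_mul, ← integral_const_mul]
    refine integral_congr_ae ?_
    have := (Measure.quasiMeasurePreserving_snd (μ := (volume : Measure (Eu n)))
      (ν := (volume : Measure (Eu n)))).ae (Lp.coeFn_smul c f)
    filter_upwards [this] with p hp
    rw [hp, Pi.smul_apply, smul_eq_mul, map_mul]; ring
  have hB3 : ∀ f g g', B f (g + g') = B f g + B f g' := by
    intro f g g'
    rw [← integral_add (hBi _ _) (hBi _ _)]
    refine integral_congr_ae ?_
    have := (Measure.quasiMeasurePreserving_fst (μ := (volume : Measure (Eu n)))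
      (ν := (volume : Measure (Eu n)))).ae (Lp.coeFn_add g g')
    filter_upwards [this] with p hp
    rw [hp, Pi.add_apply]; ring
  have hB4 : ∀ (c : ℂ) f g, B f (c • g) = RingHom.id ℂ c • B f g := by
    intro c f g
    rw [RingHom.id_apply, smul_eq_mul, ← integral_const_mul]
    refine integral_congr_ae ?_
    have := (Measure.quasiMeasurePreserving_fst (μ := (volume : Measure (Eu n)))
      (ν := (volume : Measure (Eu n)))).ae (Lp.coeFn_smul c g)
    filter_upwards [this] with p hp
    rw [hp, Pi.smul_apply, smul_eq_mul]; ring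
  let B' : L2 n →L⋆[ℂ] L2 n →L[ℂ] ℂ :=
    (LinearMap.mk₂'ₛₗ (starRingEnd ℂ) (RingHom.id ℂ) B hB1 hB2 hB3 hB4).mkContinuous₂ (∫ τ, κ τ)
      fun f g => by
        rw [mul_assoc, mul_comm ‖f‖]
        exact norm_integral_kernel_le hκ hκi hk f g _ fun p => by simp
  have hS : ∀ f g, inner ℂ (InnerProductSpace.continuousLinearMapOfBilin B' f) g = B f g :=
    fun f g => InnerProductSpace.continuousLinearMapOfBilin_apply B' f g
  have hS' : ∀ f g : L2 n, inner ℂ g (InnerProductSpace.continuousLinearMapOfBilin B' f) =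
        ∫ p : Eu n × Eu n, k p * (starRingEnd ℂ (g p.1) * f p.2) := by
    intro f g
    rw [← inner_conj_symm, hS, ← integral_conj]
    simp
  refine ⟨InnerProductSpace.continuousLinearMapOfBilin B', fun f => ?_, hS'⟩
  -- The norm bound follows by testing the form with the image of `f` itself.
  set y := InnerProductSpace.continuousLinearMapOfBilin B' f with hy
  have h1 : ‖y‖ * ‖y‖ ≤ (∫ τ, κ τ) * (‖y‖ * ‖f‖) := by
    have h2 : ‖inner ℂ y y‖ = ‖y‖ * ‖y‖ := by rw [inner_self_eq_norm_sq_to_K]; simp [sq]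
    rw [← h2]
    nth_rw 2 [hy]
    rw [hS' f y]
    exact norm_integral_kernel_le hκ hκi hk f y _ fun p => by simp
  rcases (norm_nonneg y).eq_or_lt with h0 | h0
  · rw [← h0]
    exact mul_nonneg (integral_nonneg κ0) (norm_nonneg _)
  · refine le_of_mul_le_mul_right (h1.trans_eq ?_) h0
    ring

end Schur

/-! ### Strong measurability from weak measurability -/

section Measurability

/-- The balls of radius `1/2` around the vectors of an orthonormal set are disjoint. -/
theorem countable_of_orthonormal {H : Type*} [NormedAddCommGroup H] [InnerProductSpace ℂ H]
    [SeparableSpace H] {w : Set H} (hw : Orthonormal ℂ ((↑) : w → H)) : w.Countable := by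
  have hd : w.PairwiseDisjoint fun x => Metric.ball x (1 / 2) := by
    intro x hx y hy hxy
    refine Metric.ball_disjoint_ball ?_
    have h0 : inner ℂ x y = 0 := hw.2 (i := ⟨x, hx⟩) (j := ⟨y, hy⟩) (by simpa using hxy)
    have h1 : ‖x‖ = 1 := hw.1 ⟨x, hx⟩
    have h2 : ‖y‖ = 1 := hw.1 ⟨y, hy⟩
    have h3 : ‖x - y‖ ^ 2 = 2 := by
      rw [norm_sub_sq (𝕜 := ℂ), h0, h1, h2]; norm_num
    rw [dist_eq_norm]
    nlinarith [norm_nonneg (x - y)]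
  exact hd.countable_of_isOpen (fun _ _ => Metric.isOpen_ball) fun x _ =>
    ⟨x, Metric.mem_ball_self (by norm_num)⟩

/-- A weakly measurable map into a separable Hilbert space is strongly measurable. -/
theorem stronglyMeasurable_of_inner {H : Type*} [NormedAddCommGroup H] [InnerProductSpace ℂ H]
    [CompleteSpace H] [SeparableSpace H] {Z : Type*} [MeasurableSpace Z] {f : Z → H}
    (hf : ∀ g : H, StronglyMeasurable fun z => inner ℂ g (f z)) : StronglyMeasurable f := by
  obtain ⟨w, b, hb⟩ := exists_hilbertBasis ℂ H
  have hw : Countable w := (countable_of_orthonormal (hb ▸ b.orthonormal)).to_subtype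
  refine stronglyMeasurable_of_tendsto (atTop : Filter (Finset w))
    (f := fun s z => ∑ i ∈ s, inner ℂ (b i) (f z) • b i) (fun s => ?_) ?_
  · exact Finset.stronglyMeasurable_fun_sum _ fun i _ => (hf (b i)).smul_const (b i)
  · rw [tendsto_pi_nhds]
    intro z
    have h := b.hasSum_repr (f z)
    simp only [b.repr_apply_apply] at h
    exact h

/-- A strongly measurable family of operators maps strongly measurable functions to strongly
measurable functions: `(z, x) ↦ S z x` is a Carathéodory function. -/
theorem stronglyMeasurable_clm_apply {H H' : Type*} [NormedAddCommGroup H] [NormedSpace ℂ H]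
    [SecondCountableTopology H] [NormedAddCommGroup H'] [NormedSpace ℂ H']
    {Z : Type*} [MeasurableSpace Z] {S : Z → H →L[ℂ] H'} {f : Z → H}
    (hS : ∀ x, StronglyMeasurable fun z => S z x) (hf : StronglyMeasurable f) :
    StronglyMeasurable fun z => S z (f z) := by
  borelize H
  have h := stronglyMeasurable_uncurry_of_continuous_of_stronglyMeasurable
    (u := fun x z => S z x) (fun z => (S z).continuous) hS
  exact h.comp_measurable (hf.measurable.prodMk measurable_id)

end Measurability

/-! ### Sobolev spaces on the Fourier side -/

section Spectral

variable {n : ℕ}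

/-- The weight `(1 + |η|²)^{s/2}` of the Bessel potential of order `s`. -/
def bracket (s : ℝ) (η : Eu n) : ℝ := (1 + ‖η‖ ^ 2) ^ (s / 2)

theorem bracket_pos (s : ℝ) (η : Eu n) : 0 < bracket s η := by
  unfold bracket; positivity

theorem bracket_neg_mul (s : ℝ) (η : Eu n) : bracket (-s) η * bracket s η = 1 := by
  unfold bracket
  rw [← Real.rpow_add (by positivity)]
  simp [neg_div]

theorem continuous_bracket (s : ℝ) : Continuous (bracket s : Eu n → ℝ) := by
  unfold bracket
  exact Continuous.rpow_const (by fun_prop) fun x => Or.inl (by positivity)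

theorem hasTemperateGrowth_bracket (s : ℝ) :
    Function.HasTemperateGrowth fun η : Eu n => ((bracket s η : ℝ) : ℂ) := by
  unfold bracket; fun_prop

/-- The isometry `u ↦ (1 + |η|²)^{s/2} 𝓕 u` of `H^s(ℝⁿ)` onto `L²(ℝⁿ)`. -/
def spectral (n : ℕ) (s : ℝ) : Sob n s ≃ₗᵢ[ℂ] L2 n where
  toLinearEquiv := LinearEquiv.ofBijective
    ((Lp.fourierTransformₗᵢ (Eu n) ℂ).toLinearEquiv.toLinearMap ∘ₗ Sob.toL2)
    ⟨(Lp.fourierTransformₗᵢ (Eu n) ℂ).injective.comp Sob.toL2_injective, fun g => by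
      obtain ⟨g', rfl⟩ := (Lp.fourierTransformₗᵢ (Eu n) ℂ).surjective g
      let u : 𝓢'(Eu n, ℂ) := TemperedDistribution.besselPotential (Eu n) ℂ (-s) (g' : 𝓢'(Eu n, ℂ))
      have hu : TemperedDistribution.besselPotential (Eu n) ℂ s u = (g' : 𝓢'(Eu n, ℂ)) :=
        (TemperedDistribution.besselPotential_neg_apply_eq_iff s _ _).1 rfl
      let u' : Sob n s := ⟨u, g', hu⟩
      refine ⟨u', ?_⟩
      have : Sob.toL2 u' = g' := Sob.l2_coe_injective ((Sob.besselPotential_eq u').symm.trans hu)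
      simp [this]⟩
  norm_map' u := (Lp.fourierTransformₗᵢ (Eu n) ℂ).norm_map (Sob.toL2 u)

theorem spectral_apply {s : ℝ} (u : Sob n s) : spectral n s u = 𝓕 (Sob.toL2 u) := rfl

/-- The weight `(1 + |η|²)^{-s/2}` times the element of `L²` representing `u` is `𝓕 u`. -/
theorem fourier_toDist_apply {s : ℝ} (u : Sob n s) (f : 𝓢(Eu n, ℂ)) :
    𝓕 (Sob.toDist u) f = ∫ η, f η * (bracket (-s) η * spectral n s u η) := by
  have h1 : Sob.toDist u = TemperedDistribution.besselPotential (Eu n) ℂ (-s)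
      (Sob.toL2 u : 𝓢'(Eu n, ℂ)) :=
    ((TemperedDistribution.besselPotential_neg_apply_eq_iff s _ _).2
      (Sob.besselPotential_eq u)).symm
  rw [h1, TemperedDistribution.fourier_besselPotential_eq_smulLeftCLM_fourier_apply,
    TemperedDistribution.smulLeftCLM_apply_apply, Lp.fourier_toTemperedDistribution_eq,
    Lp.toTemperedDistribution_apply]
  refine integral_congr_ae (Eventually.of_forall fun η => ?_)
  have h2 := hasTemperateGrowth_bracket (n := n) (-s)
  unfold bracket at h2
  simp only [SchwartzMap.smulLeftCLM_apply_apply h2, spectral_apply, bracket, smul_eq_mul]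
  ring

theorem toDist_apply {s : ℝ} (u : Sob n s) (f : 𝓢(Eu n, ℂ)) :
    Sob.toDist u f = ∫ η, (𝓕⁻ f) η * (bracket (-s) η * spectral n s u η) := by
  rw [← fourier_toDist_apply, TemperedDistribution.fourier_apply, FourierTransform.fourier_fourierInv_eq]

theorem integrable_schwartz_mul (f : 𝓢(Eu n, ℂ)) (s : ℝ) (g : L2 n) :
    Integrable fun η => f η * (bracket s η * g η) := by
  have h : MemLp (SchwartzMap.smulLeftCLM ℂ (fun η : Eu n => ((bracket s η : ℝ) : ℂ)) f) 2
      (volume : Measure (Eu n)) := SchwartzMap.memLp _ _ _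
  refine (h.integrable_mul (Lp.memLp g)).congr (Eventually.of_forall fun η => ?_)
  simp only [Pi.mul_apply, SchwartzMap.smulLeftCLM_apply_apply (hasTemperateGrowth_bracket s),
    smul_eq_mul]
  ring

theorem locallyIntegrable_comp_smul {h : Eu n → ℂ} (hh : LocallyIntegrable h) {c : ℝ} (hc : c ≠ 0) :
    LocallyIntegrable fun η => h (c • η) := by
  have h1 := (locallyIntegrable_map_homeomorph (Homeomorph.smulOfNeZero c hc)
    (f := h) (μ := (volume : Measure (Eu n)))).1
  refine h1 ?_
  have h2 := Measure.map_addHaar_smul (volume : Measure (Eu n)) hc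
  rw [show (⇑(Homeomorph.smulOfNeZero c hc) : Eu n → Eu n) = fun x => c • x from rfl, h2]
  exact fun x => (hh x).imp fun s hs => ⟨hs.1, by
    rw [IntegrableOn, Measure.restrict_smul]
    exact Integrable.smul_measure hs.2 ENNReal.ofReal_ne_top⟩

/-- The function representing the Fourier transform of `u ∈ H^s`, in the normalization with the
kernel `e^{-i x·ξ}`. -/
def fourierFun {s : ℝ} (u : Sob n s) (ξ : Eu n) : ℂ :=
  bracket (-s) ((2 * Real.pi)⁻¹ • ξ) * spectral n s u ((2 * Real.pi)⁻¹ • ξ)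

theorem fourierFun_smul {s : ℝ} (u : Sob n s) (η : Eu n) :
    fourierFun u ((2 * Real.pi) • η) = bracket (-s) η * spectral n s u η := by
  unfold fourierFun
  rw [inv_smul_smul₀ (by positivity)]

theorem isFourierTransform_fourierFun {s : ℝ} (u : Sob n s) :
    IsFourierTransform (Sob.toDist u) (fourierFun u) := by
  refine ⟨?_, fun f => ?_⟩
  · refine locallyIntegrable_comp_smul
      (h := fun η => bracket (-s) η * spectral n s u η) ?_ (by positivity)
    have h1 : LocallyIntegrable (spectral n s u : Eu n → ℂ) :=
      (Lp.memLp (spectral n s u)).locallyIntegrable (by norm_num)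
    have h2 : Continuous fun η : Eu n => ((bracket (-s) η : ℝ) : ℂ) :=
      Complex.continuous_ofReal.comp (continuous_bracket _)
    exact h1.continuous_smul h2
  · simp only [fourierFun_smul]
    exact ⟨integrable_schwartz_mul f (-s) _, fourier_toDist_apply u f⟩

end Spectral

/-! ### Decay of the Fourier transform of a localized symbol -/

section Amplitude

variable {n : ℕ} {G : Opens (Eu n)}

/-- The Fourier transform in `x` of the localized symbol `b(x, ξ) φ(x)`. -/
def ampFourier (b : Eu n → Eu n → ℂ) (φ : Eu n → ℂ) (ζ ξ : Eu n) : ℂ :=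
  𝓕 (fun x => b x ξ * φ x) ζ

/-- The bound `|∂_x^β b(x, ξ)| ≤ M (1 + |ξ|)^l` for `|β| ≤ N` and `x ∈ K`. -/
def SymbolLe (K : Set (Eu n)) (l : ℝ) (N : ℕ) (b : Eu n → Eu n → ℂ) (M : ℝ) : Prop :=
  ∀ j ≤ N, ∀ x ∈ K, ∀ ξ, ‖iteratedFDeriv ℝ j (fun y => b y ξ) x‖ ≤ M * (1 + ‖ξ‖) ^ l

theorem contDiff_mul_cutoff {b : Eu n → Eu n → ℂ}
    (hb : ContDiffOn ℝ ∞ (fun y : Eu n × Eu n => b y.1 y.2) ((G : Set (Eu n)) ×ˢ Set.univ))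
    {φ : Eu n → ℂ} (hφ : ContDiff ℝ ∞ φ) (hφG : tsupport φ ⊆ G) :
    ContDiff ℝ ∞ fun y : Eu n × Eu n => b y.1 y.2 * φ y.1 := by
  rw [contDiff_iff_contDiffAt]
  intro y
  by_cases hy : y.1 ∈ tsupport φ
  · have h1 : ((G : Set (Eu n)) ×ˢ (Set.univ : Set (Eu n))) ∈ 𝓝 y :=
      (G.isOpen.prod isOpen_univ).mem_nhds ⟨hφG hy, Set.mem_univ _⟩
    exact (hb.contDiffAt h1).mul (hφ.contDiffAt.comp y contDiffAt_fst)
  · have h1 : (fun y : Eu n × Eu n => b y.1 y.2 * φ y.1) =ᶠ[𝓝 y] fun _ => 0 := by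
      have h2 : {y : Eu n × Eu n | y.1 ∉ tsupport φ} ∈ 𝓝 y :=
        ((isClosed_tsupport φ).isOpen_compl.preimage continuous_fst).mem_nhds hy
      filter_upwards [h2] with y' hy'
      rw [image_eq_zero_of_notMem_tsupport hy', mul_zero]
    exact contDiffAt_const.congr_of_eventuallyEq h1

theorem contDiff_mul_cutoff_left {b : Eu n → Eu n → ℂ}
    (hb : ContDiffOn ℝ ∞ (fun y : Eu n × Eu n => b y.1 y.2) ((G : Set (Eu n)) ×ˢ Set.univ))
    {φ : Eu n → ℂ} (hφ : ContDiff ℝ ∞ φ) (hφG : tsupport φ ⊆ G) (ξ : Eu n) :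
    ContDiff ℝ ∞ fun x => b x ξ * φ x :=
  (contDiff_mul_cutoff hb hφ hφG).comp (contDiff_id.prodMk contDiff_const)

theorem norm_iteratedFDeriv_mul_cutoff_le {b : Eu n → Eu n → ℂ}
    (hb : ContDiffOn ℝ ∞ (fun y : Eu n × Eu n => b y.1 y.2) ((G : Set (Eu n)) ×ˢ Set.univ))
    {K : Set (Eu n)} (hKG : K ⊆ G) {l : ℝ} {N : ℕ} {M : ℝ} (hM : SymbolLe K l N b M)
    {φ : Eu n → ℂ} (hφ : ContDiff ℝ ∞ φ) {S : ℝ}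
    (hS : ∀ j ≤ N, ∀ x, ‖iteratedFDeriv ℝ j φ x‖ ≤ S) {j : ℕ} (hj : j ≤ N) {x : Eu n}
    (hx : x ∈ K) (ξ : Eu n) :
    ‖iteratedFDeriv ℝ j (fun x => b x ξ * φ x) x‖ ≤ 2 ^ N * (M * S * (1 + ‖ξ‖) ^ l) := by
  have hbξ : ContDiffOn ℝ ∞ (fun x => b x ξ) (G : Set (Eu n)) :=
    hb.comp (contDiff_id.prodMk contDiff_const).contDiffOn fun x hx => ⟨hx, Set.mem_univ _⟩
  have h1 := norm_iteratedFDerivWithin_mul_le hbξ hφ.contDiffOn G.isOpen.uniqueDiffOn (hKG hx)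
    (n := j) (by exact_mod_cast le_top)
  simp only [iteratedFDerivWithin_of_isOpen _ G.isOpen (hKG hx)] at h1
  have hM0 : 0 ≤ M * (1 + ‖ξ‖) ^ l := (norm_nonneg _).trans (hM 0 (Nat.zero_le _) x hx ξ)
  have hS0 : 0 ≤ S := (norm_nonneg _).trans (hS 0 (Nat.zero_le _) x)
  refine h1.trans ?_
  calc ∑ i ∈ Finset.range (j + 1), (j.choose i : ℝ) * ‖iteratedFDeriv ℝ i (fun x => b x ξ) x‖ *
        ‖iteratedFDeriv ℝ (j - i) φ x‖
      ≤ ∑ i ∈ Finset.range (j + 1), (j.choose i : ℝ) * (M * (1 + ‖ξ‖) ^ l) * S := by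
        refine Finset.sum_le_sum fun i hi => ?_
        have hi' : i ≤ j := Nat.lt_succ_iff.1 (Finset.mem_range.1 hi)
        gcongr
        · exact hM i (hi'.trans hj) x hx ξ
        · exact hS _ ((Nat.sub_le _ _).trans hj) x
    _ = 2 ^ j * (M * S * (1 + ‖ξ‖) ^ l) := by
        rw [← Finset.sum_mul, ← Finset.sum_mul, ← Nat.cast_sum, Nat.sum_range_choose]
        push_cast; ring
    _ ≤ _ := by
        have : 0 ≤ M * S * (1 + ‖ξ‖) ^ l := by
          rw [mul_right_comm]; exact mul_nonneg hM0 hS0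
        gcongr
        norm_num

/-- Integration by parts: the Fourier transform in `x` of a localized symbol decays rapidly. -/
theorem norm_ampFourier_le {b : Eu n → Eu n → ℂ}
    (hb : ContDiffOn ℝ ∞ (fun y : Eu n × Eu n => b y.1 y.2) ((G : Set (Eu n)) ×ˢ Set.univ))
    {K : Set (Eu n)} (hK : IsCompact K) (hKG : K ⊆ G) {l : ℝ} {N : ℕ} {M : ℝ} (hM0 : 0 ≤ M)
    (hM : SymbolLe K l N b M) {φ : Eu n → ℂ} (hφ : ContDiff ℝ ∞ φ) (hφK : tsupport φ ⊆ K) {S : ℝ}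
    (hS : ∀ j ≤ N, ∀ x, ‖iteratedFDeriv ℝ j φ x‖ ≤ S) (ζ ξ : Eu n) :
    ‖ampFourier b φ ζ ξ‖ ≤ 4 ^ N * (N + 2) * 2 ^ N * volume.real K * (M * S * (1 + ‖ξ‖) ^ l) *
      (1 + ‖ζ‖) ^ (-(N : ℝ)) := by
  set c : Eu n → ℂ := fun x => b x ξ * φ x with hc
  have hS0 : 0 ≤ S := (norm_nonneg _).trans (hS 0 (Nat.zero_le _) 0)
  set X : ℝ := M * S * (1 + ‖ξ‖) ^ l with hX
  have hX0 : 0 ≤ X := by positivity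
  have hcd : ContDiff ℝ ∞ c := contDiff_mul_cutoff_left hb hφ (hφK.trans hKG) ξ
  have hcs : tsupport c ⊆ K := tsupport_mul_subset_right.trans hφK
  have hcc : HasCompactSupport c := hK.of_isClosed_subset (isClosed_tsupport c) hcs
  have hint : ∀ j : ℕ, Integrable (iteratedFDeriv ℝ j c) := fun j =>
    (hcd.continuous_iteratedFDeriv (by exact_mod_cast le_top)).integrable_of_hasCompactSupport
      (hcc.iteratedFDeriv j)
  have hbd : ∀ j ≤ N, ∫ v, ‖iteratedFDeriv ℝ j c v‖ ≤ 2 ^ N * X * volume.real K := by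
    intro j hj
    rw [← setIntegral_eq_integral_of_forall_compl_eq_zero (s := K) fun x hx => ?_]
    · refine (Real.le_norm_self _).trans
        (norm_setIntegral_le_of_norm_le_const hK.measure_lt_top fun x hx => ?_)
      rw [norm_norm]
      exact norm_iteratedFDeriv_mul_cutoff_le hb hKG hM hφ hS hj hx ξ
    · rw [norm_eq_zero]
      exact Function.notMem_support.1 fun h => hx (hcs (support_iteratedFDeriv_subset j h))
  have hpow : ∀ m ≤ N, ‖ζ‖ ^ m * ‖𝓕 c ζ‖ ≤ 2 ^ N * (N + 1) * (2 ^ N * X * volume.real K) := by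
    intro m hm
    have h := Real.pow_mul_norm_iteratedFDeriv_fourier_le (K := 0) (N := ⊤) (f := c)
      (by exact_mod_cast hcd) (fun k j hk _ => by
        have hk0 : k = 0 := by simpa using hk
        simpa [hk0] using (hint j).norm) (k := 0) (n := m) le_rfl le_top ζ
    simp only [norm_iteratedFDeriv_zero] at h
    refine h.trans ?_
    have h2 : ∑ p ∈ Finset.range (0 + 1) ×ˢ Finset.range (m + 1),
        ∫ v, ‖v‖ ^ p.1 * ‖iteratedFDeriv ℝ p.2 c v‖ ≤ (N + 1) * (2 ^ N * X * volume.real K) := by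
      calc _ ≤ ∑ p ∈ Finset.range (0 + 1) ×ˢ Finset.range (m + 1),
            2 ^ N * X * volume.real K := by
            refine Finset.sum_le_sum fun p hp => ?_
            simp only [Finset.mem_product, Finset.mem_range] at hp
            have hp0 : p.1 = 0 := by omega
            simp only [hp0, pow_zero, one_mul]
            exact hbd _ (by omega)
        _ = (m + 1) * (2 ^ N * X * volume.real K) := by simp
        _ ≤ _ := by gcongr
    have h3 : (2 : ℝ) ^ m ≤ 2 ^ N := pow_le_pow_right₀ (by norm_num) hm
    calc _ ≤ 1 * 2 ^ N * ((N + 1) * (2 ^ N * X * volume.real K)) := by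
          have h0 : 0 ≤ (N + 1) * (2 ^ N * X * volume.real K) := by positivity
          norm_num at h2 ⊢
          exact mul_le_mul h3 h2 (Finset.sum_nonneg fun p _ => by positivity) (by positivity)
      _ = _ := by ring
  -- The case `m = 0` without the lossy constant, for the term `1` in `1 + |ζ|^N`.
  have h1 : ‖𝓕 c ζ‖ ≤ 2 ^ N * X * volume.real K := by
    have := Real.pow_mul_norm_iteratedFDeriv_fourier_le (K := 0) (N := ⊤) (f := c)
      (by exact_mod_cast hcd) (fun k j hk _ => by
        have hk0 : k = 0 := by simpa using hk
        simpa [hk0] using (hint j).norm) (k := 0) (n := 0) le_rfl le_top ζ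
    simp only [norm_iteratedFDeriv_zero] at this
    refine le_trans ?_ (hbd 0 (Nat.zero_le _))
    simpa using this
  have h4 : (1 + ‖ζ‖) ^ N ≤ 2 ^ N * (1 + ‖ζ‖ ^ N) := by
    refine (add_pow_le zero_le_one (norm_nonneg ζ) N).trans ?_
    rw [one_pow]
    gcongr
    · norm_num
    · exact Nat.sub_le _ _
  have h5 : (1 + ‖ζ‖) ^ N * ‖𝓕 c ζ‖ ≤ 4 ^ N * (N + 2) * 2 ^ N * volume.real K * X := by
    calc (1 + ‖ζ‖) ^ N * ‖𝓕 c ζ‖ ≤ 2 ^ N * (1 + ‖ζ‖ ^ N) * ‖𝓕 c ζ‖ := by gcongr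
      _ = 2 ^ N * (‖𝓕 c ζ‖ + ‖ζ‖ ^ N * ‖𝓕 c ζ‖) := by ring
      _ ≤ 2 ^ N * (2 ^ N * (2 ^ N * X * volume.real K) +
            2 ^ N * (N + 1) * (2 ^ N * X * volume.real K)) := by
          have h6 : 2 ^ N * X * volume.real K ≤ 2 ^ N * (2 ^ N * X * volume.real K) :=
            le_mul_of_one_le_left (by positivity) (one_le_pow₀ (by norm_num))
          exact mul_le_mul_of_nonneg_left (add_le_add (h1.trans h6) (hpow N le_rfl))
            (by positivity)
      _ = _ := by
          rw [show (4 : ℝ) = 2 * 2 by norm_num, mul_pow]; ring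
  rw [Real.rpow_neg (by positivity), Real.rpow_natCast, ← div_eq_mul_inv,
    le_div_iff₀ (by positivity), mul_comm]
  exact h5

theorem bracket_le (s : ℝ) (η : Eu n) : bracket s η ≤ 2 ^ |s| * (1 + ‖η‖) ^ s := by
  unfold bracket
  have hη := norm_nonneg η
  rcases le_total 0 s with hs | hs
  · calc (1 + ‖η‖ ^ 2) ^ (s / 2) ≤ ((1 + ‖η‖) ^ (2 : ℝ)) ^ (s / 2) := by
          refine Real.rpow_le_rpow (by positivity) ?_ (by positivity)
          rw [Real.rpow_two]; nlinarith
      _ = (1 + ‖η‖) ^ s := by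
          rw [← Real.rpow_mul (by positivity)]; congr 1; ring
      _ ≤ _ := le_mul_of_one_le_left (by positivity)
          (Real.one_le_rpow (by norm_num) (abs_nonneg _))
  · calc (1 + ‖η‖ ^ 2) ^ (s / 2) ≤ ((2 : ℝ) ^ (-2 : ℝ) * (1 + ‖η‖) ^ (2 : ℝ)) ^ (s / 2) := by
          refine Real.rpow_le_rpow_of_nonpos (by positivity) ?_ (by linarith)
          rw [Real.rpow_two, Real.rpow_neg (by norm_num), Real.rpow_two]
          nlinarith [sq_nonneg (1 - ‖η‖)]
      _ = _ := by
          rw [Real.mul_rpow (by positivity) (by positivity), ← Real.rpow_mul (by positivity),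
            ← Real.rpow_mul (by positivity), abs_of_nonpos hs]
          congr 2 <;> ring

/-- Peetre's inequality. -/
theorem peetre (r : ℝ) (ζ η : Eu n) :
    (1 + ‖ζ‖) ^ r ≤ (1 + ‖η‖) ^ r * (1 + ‖ζ - η‖) ^ |r| := by
  have h0 := norm_nonneg ζ
  have h1 := norm_nonneg η
  have h2 := norm_nonneg (ζ - η)
  rcases le_total 0 r with hr | hr
  · rw [abs_of_nonneg hr, ← Real.mul_rpow (by positivity) (by positivity)]
    refine Real.rpow_le_rpow (by positivity) ?_ hr
    have : ‖ζ‖ ≤ ‖η‖ + ‖ζ - η‖ := by simpa using norm_add_le η (ζ - η)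
    nlinarith
  · have h3 : (1 + ‖η‖) ^ (-r) ≤ (1 + ‖ζ‖) ^ (-r) * (1 + ‖ζ - η‖) ^ (-r) := by
      rw [← Real.mul_rpow (by positivity) (by positivity)]
      refine Real.rpow_le_rpow (by positivity) ?_ (by linarith)
      have : ‖η‖ ≤ ‖ζ‖ + ‖ζ - η‖ := by simpa [norm_sub_rev] using norm_add_le ζ (η - ζ)
      nlinarith
    rw [abs_of_nonpos hr]
    rw [Real.rpow_neg (by positivity), Real.rpow_neg (x := 1 + ‖ζ‖) (by positivity)] at h3
    have h4 : 0 < (1 + ‖η‖) ^ r := by positivity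
    have h5 : 0 < (1 + ‖ζ‖) ^ r := by positivity
    have h6 := mul_le_mul_of_nonneg_left h3 (mul_nonneg h4.le h5.le)
    field_simp at h6
    linarith

theorem one_add_norm_smul_rpow_le (l : ℝ) (η : Eu n) :
    (1 + ‖(2 * Real.pi) • η‖) ^ l ≤ (2 * Real.pi) ^ |l| * (1 + ‖η‖) ^ l := by
  have hπ : (1 : ℝ) ≤ 2 * Real.pi := by linarith [Real.pi_gt_three]
  have h0 := norm_nonneg η
  rw [norm_smul, Real.norm_of_nonneg (by positivity)]
  rcases le_total 0 l with hl | hl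
  · rw [abs_of_nonneg hl, ← Real.mul_rpow (by positivity) (by positivity)]
    refine Real.rpow_le_rpow (by positivity) ?_ hl
    nlinarith
  · calc (1 + 2 * Real.pi * ‖η‖) ^ l ≤ (1 + ‖η‖) ^ l := by
          refine Real.rpow_le_rpow_of_nonpos (by positivity) ?_ hl
          nlinarith
      _ ≤ _ := le_mul_of_one_le_left (by positivity) (Real.one_le_rpow hπ (abs_nonneg _))

/-- The kernel on the Fourier side of the map `u ↦ φ · b(x, D) u` from `H^s` to `H^r`: it is
conjugated by the weights, so that it acts on `L²`. -/
def cutKernel (b : Eu n → Eu n → ℂ) (φ : Eu n → ℂ) (r s : ℝ) (p : Eu n × Eu n) : ℂ :=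
  bracket r p.1 * ampFourier b φ (p.1 - p.2) ((2 * Real.pi) • p.2) * bracket (-s) p.2

/-- The number of derivatives in `x` of the symbol that the bound into `H^r` requires: `|r|` of them
are spent in Peetre's inequality, and `n + 1` make the kernel integrable. -/
def decayOrder (n : ℕ) (r : ℝ) : ℕ := ⌈|r|⌉₊ + n + 1

/-- The integrable function that dominates the kernels. -/
def decay (n : ℕ) (τ : Eu n) : ℝ := (1 + ‖τ‖) ^ (-((n : ℝ) + 1))

theorem decay_nonneg (τ : Eu n) : 0 ≤ decay n τ := by unfold decay; positivity

theorem decay_neg (τ : Eu n) : decay n (-τ) = decay n τ := by simp [decay]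

theorem measurable_decay : Measurable (decay n) := by unfold decay; fun_prop

theorem integrable_decay : Integrable (decay n) :=
  integrable_one_add_norm (by simp)

theorem memLp_decay : MemLp (decay n) 2 := by
  rw [memLp_two_iff_integrable_sq measurable_decay.aestronglyMeasurable]
  refine integrable_decay.mono' (measurable_decay.pow_const 2).aestronglyMeasurable
    (Eventually.of_forall fun τ => ?_)
  have h1 : decay n τ ≤ 1 := Real.rpow_le_one_of_one_le_of_nonpos
    (by linarith [norm_nonneg τ]) (by linarith [(n.cast_nonneg : (0 : ℝ) ≤ n)])
  have h0 := decay_nonneg τ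
  rw [Real.norm_of_nonneg (by positivity)]
  nlinarith

/-- The constant in the kernel bound. -/
def kernelConst (n : ℕ) (K : Set (Eu n)) (l s : ℝ) : ℝ :=
  2 ^ |s - l| * 2 ^ |s| * (2 * Real.pi) ^ |l| * (4 ^ decayOrder n (s - l) *
    (decayOrder n (s - l) + 2) * 2 ^ decayOrder n (s - l) * volume.real K)

theorem kernelConst_nonneg (K : Set (Eu n)) (l s : ℝ) : 0 ≤ kernelConst n K l s := by
  unfold kernelConst; positivity

theorem norm_cutKernel_le {b : Eu n → Eu n → ℂ}
    (hb : ContDiffOn ℝ ∞ (fun y : Eu n × Eu n => b y.1 y.2) ((G : Set (Eu n)) ×ˢ Set.univ))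
    {K : Set (Eu n)} (hK : IsCompact K) (hKG : K ⊆ G) {l s : ℝ} {M : ℝ} (hM0 : 0 ≤ M)
    (hM : SymbolLe K l (decayOrder n (s - l)) b M) {φ : Eu n → ℂ} (hφ : ContDiff ℝ ∞ φ)
    (hφK : tsupport φ ⊆ K) {S : ℝ}
    (hS : ∀ j ≤ decayOrder n (s - l), ∀ x, ‖iteratedFDeriv ℝ j φ x‖ ≤ S) (p : Eu n × Eu n) :
    ‖cutKernel b φ (s - l) s p‖ ≤ kernelConst n K l s * M * S * decay n (p.1 - p.2) := by
  obtain ⟨ζ, η⟩ := p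
  have hS0 : 0 ≤ S := (norm_nonneg _).trans (hS 0 (Nat.zero_le _) 0)
  set N := decayOrder n (s - l) with hN
  have h1 := norm_ampFourier_le hb hK hKG hM0 hM hφ hφK hS (ζ - η) ((2 * Real.pi) • η)
  set C : ℝ := 4 ^ N * (N + 2) * 2 ^ N * volume.real K with hC
  have hC0 : 0 ≤ C := by positivity
  have h2 : (1 + ‖ζ‖) ^ (s - l) * (1 + ‖η‖) ^ l * (1 + ‖η‖) ^ (-s) *
      (1 + ‖ζ - η‖) ^ (-(N : ℝ)) ≤ decay n (ζ - η) := by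
    calc _ ≤ ((1 + ‖η‖) ^ (s - l) * (1 + ‖ζ - η‖) ^ |s - l|) * (1 + ‖η‖) ^ l * (1 + ‖η‖) ^ (-s) *
          (1 + ‖ζ - η‖) ^ (-(N : ℝ)) := by
          gcongr
          exact peetre _ _ _
      _ = ((1 + ‖η‖) ^ (s - l) * (1 + ‖η‖) ^ l * (1 + ‖η‖) ^ (-s)) *
          ((1 + ‖ζ - η‖) ^ |s - l| * (1 + ‖ζ - η‖) ^ (-(N : ℝ))) := by ring
      _ = (1 + ‖ζ - η‖) ^ (|s - l| - N) := by
          rw [← Real.rpow_add (by positivity), ← Real.rpow_add (by positivity),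
            ← Real.rpow_add (by positivity)]
          simp [sub_eq_add_neg]
      _ ≤ _ := by
          unfold decay
          refine Real.rpow_le_rpow_of_exponent_le (by linarith [norm_nonneg (ζ - η)]) ?_
          have := Nat.le_ceil |s - l|
          rw [hN, decayOrder]
          push_cast
          linarith
  have e1 := bracket_le (s - l) ζ
  have e2 := bracket_le (-s) η
  have e3 := one_add_norm_smul_rpow_le l η
  rw [abs_neg] at e2
  have hn : ‖cutKernel b φ (s - l) s (ζ, η)‖ =
      bracket (s - l) ζ * ‖ampFourier b φ (ζ - η) ((2 * Real.pi) • η)‖ * bracket (-s) η := by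
    simp only [cutKernel, norm_mul, Complex.norm_real]
    rw [Real.norm_of_nonneg (bracket_pos _ _).le, Real.norm_of_nonneg (bracket_pos _ _).le]
  rw [hn]
  have b1 := (bracket_pos (s - l) ζ).le
  have b2 := (bracket_pos (-s) η).le
  calc _ ≤ (2 ^ |s - l| * (1 + ‖ζ‖) ^ (s - l)) * (C * (M * S * ((2 * Real.pi) ^ |l| *
        (1 + ‖η‖) ^ l)) * (1 + ‖ζ - η‖) ^ (-(N : ℝ))) * (2 ^ |s| * (1 + ‖η‖) ^ (-s)) := by
        gcongr
        exact h1.trans (by gcongr)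
    _ = kernelConst n K l s * M * S * ((1 + ‖ζ‖) ^ (s - l) * (1 + ‖η‖) ^ l * (1 + ‖η‖) ^ (-s) *
        (1 + ‖ζ - η‖) ^ (-(N : ℝ))) := by
        rw [kernelConst, ← hN, ← hC]; ring
    _ ≤ _ := by
        refine mul_le_mul_of_nonneg_left h2 ?_
        have := kernelConst_nonneg K l s
        positivity

/-- Joint measurability, also in a parameter `z` of the symbol. Only measurability in `z` at fixed
`(x, ξ)` is assumed, since the localized symbol is a Carathéodory function. -/
theorem stronglyMeasurable_ampFourier {Z : Type*} [MeasurableSpace Z] {b : Z → Eu n → Eu n → ℂ}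
    (hb : ∀ z, ContDiffOn ℝ ∞ (fun y : Eu n × Eu n => b z y.1 y.2)
      ((G : Set (Eu n)) ×ˢ Set.univ))
    (hbm : ∀ x ∈ G, ∀ ξ, StronglyMeasurable fun z => b z x ξ)
    {φ : Eu n → ℂ} (hφ : ContDiff ℝ ∞ φ) (hφG : tsupport φ ⊆ G) :
    StronglyMeasurable fun q : Z × (Eu n × Eu n) => ampFourier (b q.1) φ q.2.1 q.2.2 := by
  have h1 : StronglyMeasurable (Function.uncurry fun (y : Eu n × Eu n) (z : Z) =>
      b z y.1 y.2 * φ y.1) := by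
    refine stronglyMeasurable_uncurry_of_continuous_of_stronglyMeasurable
      (fun z => (contDiff_mul_cutoff (hb z) hφ hφG).continuous) fun y => ?_
    by_cases hy : y.1 ∈ tsupport φ
    · exact (hbm _ (hφG hy) _).mul_const _
    · simp only [image_eq_zero_of_notMem_tsupport hy, mul_zero]
      exact stronglyMeasurable_const
  have h2 : StronglyMeasurable (Function.uncurry fun (q : Z × (Eu n × Eu n)) (x : Eu n) =>
      Real.fourierChar (-inner ℝ x q.2.1) • (b q.1 x q.2.2 * φ x)) := by
    have hc : Continuous fun y : Eu n × Eu n => (Real.fourierChar (-inner ℝ y.1 y.2) : ℂ) := by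
      have : Continuous fun y : Eu n × Eu n => -inner ℝ y.1 y.2 :=
        (continuous_fst.inner continuous_snd).neg
      exact continuous_subtype_val.comp (Real.continuous_fourierChar.comp this)
    have hm : Measurable fun w : (Z × (Eu n × Eu n)) × Eu n => (w.2, w.1.2.1) := by fun_prop
    have h3 := hc.stronglyMeasurable.comp_measurable hm
    have h4 : StronglyMeasurable fun w : (Z × (Eu n × Eu n)) × Eu n =>
        b w.1.1 w.2 w.1.2.2 * φ w.2 :=
      h1.comp_measurable (g := fun w : (Z × (Eu n × Eu n)) × Eu n => ((w.2, w.1.2.2), w.1.1))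
        (by fun_prop)
    exact h3.mul h4
  have h5 := h2.integral_prod_right (ν := (volume : Measure (Eu n)))
  exact h5

theorem stronglyMeasurable_cutKernel {Z : Type*} [MeasurableSpace Z] {b : Z → Eu n → Eu n → ℂ}
    (hb : ∀ z, ContDiffOn ℝ ∞ (fun y : Eu n × Eu n => b z y.1 y.2)
      ((G : Set (Eu n)) ×ˢ Set.univ))
    (hbm : ∀ x ∈ G, ∀ ξ, StronglyMeasurable fun z => b z x ξ)
    {φ : Eu n → ℂ} (hφ : ContDiff ℝ ∞ φ) (hφG : tsupport φ ⊆ G) (r s : ℝ) :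
    StronglyMeasurable fun q : Z × (Eu n × Eu n) => cutKernel (b q.1) φ r s q.2 := by
  have h1 := (stronglyMeasurable_ampFourier hb hbm hφ hφG).comp_measurable
    (g := fun q : Z × (Eu n × Eu n) => (q.1, (q.2.1 - q.2.2, (2 * Real.pi) • q.2.2)))
    (by fun_prop)
  have h2 : ∀ t : ℝ, Continuous fun η : Eu n => ((bracket t η : ℝ) : ℂ) := fun t =>
    Complex.continuous_ofReal.comp (continuous_bracket t)
  have h3 := (h2 r).stronglyMeasurable.comp_measurable
    (g := fun q : Z × (Eu n × Eu n) => q.2.1) (by fun_prop)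
  have h4 := (h2 (-s)).stronglyMeasurable.comp_measurable
    (g := fun q : Z × (Eu n × Eu n) => q.2.2) (by fun_prop)
  exact (h3.mul h1).mul h4

/-- The case of a symbol without parameter. -/
theorem measurable_cutKernel {b : Eu n → Eu n → ℂ}
    (hb : ContDiffOn ℝ ∞ (fun y : Eu n × Eu n => b y.1 y.2) ((G : Set (Eu n)) ×ˢ Set.univ))
    {φ : Eu n → ℂ} (hφ : ContDiff ℝ ∞ φ) (hφG : tsupport φ ⊆ G) (r s : ℝ) :
    Measurable (cutKernel b φ r s) :=
  ((stronglyMeasurable_cutKernel (Z := Unit) (b := fun _ => b) (fun _ => hb)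
    (fun _ _ _ => stronglyMeasurable_const) hφ hφG r s).comp_measurable
    (g := fun p : Eu n × Eu n => ((), p)) (by fun_prop)).measurable

end Amplitude

/-! ### The pseudo-differential operator at a fixed time -/

section Operator

variable {n : ℕ} {G : Opens (Eu n)}

/-- A deterministic symbol of order `l`: smooth on `G × ℝⁿ`, with the bounds on the derivatives in
`x` (those in `ξ` play no role for the continuity between Sobolev spaces). -/
structure IsLocalSymbol (G : Opens (Eu n)) (l : ℝ) (b : Eu n → Eu n → ℂ) : Prop where
  smooth : ContDiffOn ℝ ∞ (fun y : Eu n × Eu n => b y.1 y.2) ((G : Set (Eu n)) ×ˢ Set.univ)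
  bound : ∀ (N : ℕ) (K : Set (Eu n)), IsCompact K → K ⊆ G → ∃ M, 0 ≤ M ∧ SymbolLe K l N b M

/-- The weight in `ζ` is `1` at `ζ = 0`, so the kernel bound also controls `⟨Au, φ⟩`. -/
theorem cutKernel_zero (b : Eu n → Eu n → ℂ) (φ : Eu n → ℂ) (r s : ℝ) (η : Eu n) :
    cutKernel b φ r s (0, η) = ampFourier b φ (-η) ((2 * Real.pi) • η) * bracket (-s) η := by
  simp [cutKernel, bracket]

theorem integrable_decay_mul_norm (f : L2 n) : Integrable fun η => decay n η * ‖f η‖ :=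
  memLp_decay.integrable_mul (Lp.memLp f).norm

theorem exists_norm_iteratedFDeriv_le (φ : 𝓓(G, ℂ)) (N : ℕ) :
    ∃ S, ∀ j ≤ N, ∀ x, ‖iteratedFDeriv ℝ j φ x‖ ≤ S := by
  have h : ∀ j : ℕ, ∃ S, ∀ x, ‖iteratedFDeriv ℝ j φ x‖ ≤ S := fun j =>
    (φ.contDiff.continuous_iteratedFDeriv (m := j)
      (by exact_mod_cast le_top)).bounded_above_of_compact_support
      (φ.hasCompactSupport.iteratedFDeriv j)
  choose S hS using h
  refine ⟨∑ j ∈ Finset.range (N + 1), S j, fun j hj x => (hS j x).trans ?_⟩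
  exact Finset.single_le_sum (f := S) (fun i _ => (norm_nonneg _).trans (hS i 0))
    (Finset.mem_range.2 (Nat.lt_succ_of_le hj))

/-- The integrand of `⟨Au, φ⟩` on the Fourier side, after the substitution `ξ = 2πη`. -/
def pdoIntegrand (b : Eu n → Eu n → ℂ) (s : ℝ) (f : L2 n) (φ : Eu n → ℂ) (η : Eu n) : ℂ :=
  ampFourier b φ (-η) ((2 * Real.pi) • η) * (bracket (-s) η * f η)

theorem norm_pdoIntegrand_le {b : Eu n → Eu n → ℂ}
    (hb : ContDiffOn ℝ ∞ (fun y : Eu n × Eu n => b y.1 y.2) ((G : Set (Eu n)) ×ˢ Set.univ))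
    {K : Set (Eu n)} (hK : IsCompact K) (hKG : K ⊆ G) {l s : ℝ} {M : ℝ} (hM0 : 0 ≤ M)
    (hM : SymbolLe K l (decayOrder n (s - l)) b M) {φ : Eu n → ℂ} (hφ : ContDiff ℝ ∞ φ)
    (hφK : tsupport φ ⊆ K) {S : ℝ}
    (hS : ∀ j ≤ decayOrder n (s - l), ∀ x, ‖iteratedFDeriv ℝ j φ x‖ ≤ S) (f : L2 n) (η : Eu n) :
    ‖pdoIntegrand b s f φ η‖ ≤ kernelConst n K l s * M * S * (decay n η * ‖f η‖) := by
  have h := norm_cutKernel_le hb hK hKG hM0 hM hφ hφK hS (0, η)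
  rw [cutKernel_zero, zero_sub, decay_neg] at h
  rw [pdoIntegrand, ← mul_assoc, norm_mul, ← mul_assoc]
  gcongr

theorem integrable_pdoIntegrand {l : ℝ} {b : Eu n → Eu n → ℂ} (hb : IsLocalSymbol G l b) (s : ℝ)
    (f : L2 n) (φ : 𝓓(G, ℂ)) : Integrable (pdoIntegrand b s f φ) := by
  obtain ⟨M, hM0, hM⟩ := hb.bound (decayOrder n (s - l)) (tsupport φ) φ.hasCompactSupport
    φ.tsupport_subset
  obtain ⟨S, hS⟩ := exists_norm_iteratedFDeriv_le φ (decayOrder n (s - l))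
  refine ((integrable_decay_mul_norm f).const_mul (kernelConst n (tsupport φ) l s * M * S)).mono'
    ?_ (Eventually.of_forall fun η => norm_pdoIntegrand_le hb.smooth φ.hasCompactSupport
      φ.tsupport_subset hM0 hM φ.contDiff subset_rfl hS f η)
  have h1 := (measurable_cutKernel hb.smooth φ.contDiff φ.tsupport_subset (s - l) s).comp
    (measurable_prodMk_left (x := (0 : Eu n)))
  have h2 := h1.mul (Lp.stronglyMeasurable f).measurable
  refine h2.aestronglyMeasurable.congr (Eventually.of_forall fun η => ?_)
  simp only [Pi.mul_apply, Function.comp_apply, cutKernel_zero, pdoIntegrand]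
  ring

theorem integrable_mul_testFunction {b : Eu n → Eu n → ℂ}
    (hb : ContDiffOn ℝ ∞ (fun y : Eu n × Eu n => b y.1 y.2) ((G : Set (Eu n)) ×ˢ Set.univ))
    (φ : 𝓓(G, ℂ)) (ξ : Eu n) : Integrable fun x => b x ξ * φ x :=
  (contDiff_mul_cutoff_left hb φ.contDiff φ.tsupport_subset
    ξ).continuous.integrable_of_hasCompactSupport φ.hasCompactSupport.mul_left

theorem ampFourier_add {b : Eu n → Eu n → ℂ}
    (hb : ContDiffOn ℝ ∞ (fun y : Eu n × Eu n => b y.1 y.2) ((G : Set (Eu n)) ×ˢ Set.univ))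
    (φ φ' : 𝓓(G, ℂ)) (ζ ξ : Eu n) :
    ampFourier b (φ + φ' : 𝓓(G, ℂ)) ζ ξ = ampFourier b φ ζ ξ + ampFourier b φ' ζ ξ := by
  have h := congrFun (VectorFourier.fourierIntegral_add (μ := (volume : Measure (Eu n)))
    Real.continuous_fourierChar (L := innerₗ (Eu n)) continuous_inner
    (integrable_mul_testFunction hb φ ξ) (integrable_mul_testFunction hb φ' ξ)) ζ
  refine Eq.trans ?_ h
  have : (fun x => b x ξ * (φ + φ' : 𝓓(G, ℂ)) x) =
      (fun x => b x ξ * φ x) + fun x => b x ξ * φ' x := by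
    ext x; simp [mul_add]
  rw [ampFourier, this]; rfl

theorem ampFourier_smul (b : Eu n → Eu n → ℂ) (c : ℂ) (φ : 𝓓(G, ℂ)) (ζ ξ : Eu n) :
    ampFourier b (c • φ : 𝓓(G, ℂ)) ζ ξ = c * ampFourier b φ ζ ξ := by
  simp only [ampFourier, Real.fourier_eq]
  rw [← integral_const_mul]
  refine integral_congr_ae (Eventually.of_forall fun x => ?_)
  simp only [Circle.smul_def, smul_eq_mul, smul_apply]
  ring

/-- The distribution `φ ↦ ⟨Au, φ⟩`, for `u` with weighted Fourier transform `f ∈ L²`. -/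
def pdoDist {l : ℝ} {b : Eu n → Eu n → ℂ} (hb : IsLocalSymbol G l b) (s : ℝ) (f : L2 n) :
    𝓓(G, ℂ) →L[ℂ] ℂ :=
  TestFunction.mkCLM ℂ (fun φ => ∫ η, pdoIntegrand b s f φ η)
    (fun φ φ' => by
      rw [← integral_add (integrable_pdoIntegrand hb s f φ) (integrable_pdoIntegrand hb s f φ')]
      refine integral_congr_ae (Eventually.of_forall fun η => ?_)
      simp only [pdoIntegrand, ampFourier_add hb.smooth, add_mul])
    (fun c φ => by
      rw [smul_eq_mul, ← integral_const_mul]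
      refine integral_congr_ae (Eventually.of_forall fun η => ?_)
      simp only [pdoIntegrand, ampFourier_smul, mul_assoc])
    (fun K hKG => by
      obtain ⟨M, hM0, hM⟩ := hb.bound (decayOrder n (s - l)) K K.isCompact hKG
      refine (ContDiffMapSupportedIn.mkCLMtoNormedSpace ℂ (n := ⊤) (K := K)
        (fun φ : 𝓓_{K}(Eu n, ℂ) =>
          ∫ η, pdoIntegrand b s f (TestFunction.ofSupportedIn hKG φ) η) ?_ ?_ ?_).continuous
      · intro φ φ'
        rw [← integral_add (integrable_pdoIntegrand hb s f _) (integrable_pdoIntegrand hb s f _)]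
        refine integral_congr_ae (Eventually.of_forall fun η => ?_)
        have : TestFunction.ofSupportedIn hKG (φ + φ') =
            TestFunction.ofSupportedIn hKG φ + TestFunction.ofSupportedIn hKG φ' := rfl
        simp only [pdoIntegrand, this, ampFourier_add hb.smooth, add_mul]
      · intro c φ
        rw [smul_eq_mul, ← integral_const_mul]
        refine integral_congr_ae (Eventually.of_forall fun η => ?_)
        have : TestFunction.ofSupportedIn hKG (c • φ) = c • TestFunction.ofSupportedIn hKG φ := rfl
        simp only [pdoIntegrand, this, ampFourier_smul, mul_assoc]
      · refine ⟨Finset.Iic (decayOrder n (s - l)),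
          kernelConst n K l s * M * ∫ η, decay n η * ‖f η‖, ?_, fun φ => ?_⟩
        · have h1 := kernelConst_nonneg (K : Set (Eu n)) l s
          have h2 : 0 ≤ ∫ η, decay n η * ‖f η‖ :=
            integral_nonneg fun η => mul_nonneg (decay_nonneg η) (norm_nonneg _)
          positivity
        · set S := (Finset.Iic (decayOrder n (s - l))).sup
            (fun i => ContDiffMapSupportedIn.seminorm ℂ (Eu n) ℂ ⊤ K i) φ with hSdef
          have hS : ∀ j ≤ decayOrder n (s - l), ∀ x, ‖iteratedFDeriv ℝ j φ x‖ ≤ S :=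
            fun j hj x => (ContDiffMapSupportedIn.norm_iteratedFDeriv_apply_le_seminorm_top ℂ).trans
              (Seminorm.le_finset_sup_apply (Finset.mem_Iic.2 hj))
          have hle := fun η => norm_pdoIntegrand_le hb.smooth K.isCompact hKG hM0 hM
            φ.contDiff φ.tsupport_subset hS f η
          refine (norm_integral_le_of_norm_le ((integrable_decay_mul_norm f).const_mul _)
            (Eventually.of_forall hle)).trans_eq ?_
          rw [integral_const_mul]
          ring)

theorem pdoDist_apply {l : ℝ} {b : Eu n → Eu n → ℂ} (hb : IsLocalSymbol G l b) (s : ℝ) (f : L2 n)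
    (φ : 𝓓(G, ℂ)) : pdoDist hb s f φ = ∫ η, pdoIntegrand b s f φ η := rfl

theorem ampFourier_eq_integral_exp (b : Eu n → Eu n → ℂ) (φ : Eu n → ℂ) (η ξ : Eu n) :
    ampFourier b φ (-η) ξ =
      ∫ x, Complex.exp (Complex.I * (inner ℝ x ((2 * Real.pi) • η) : ℝ)) * b x ξ * φ x := by
  rw [ampFourier, Real.fourier_eq']
  refine integral_congr_ae (Eventually.of_forall fun x => ?_)
  simp only [inner_neg_right, inner_smul_right, smul_eq_mul, mul_assoc]
  congr 2
  push_cast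
  ring

/-- `pdoDist` is the operator of the definition: the substitution `ξ = 2πη` accounts for the factor
`(2π)^{-n}`. -/
theorem isPDOValue_pdoDist {l s : ℝ} {b : Eu n → Eu n → ℂ} (hb : IsLocalSymbol G l b)
    (u : Sob n s) : IsPDOValue G b (Sob.toDist u) (pdoDist hb s (spectral n s u)) := by
  refine ⟨fourierFun u, isFourierTransform_fourierFun u, fun φ => ?_⟩
  set F : Eu n → ℂ := fun ξ =>
    (∫ x, Complex.exp (Complex.I * (inner ℝ x ξ : ℝ)) * b x ξ * φ x) * fourierFun u ξ with hF
  have hπ : (2 * Real.pi) ≠ 0 := by positivity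
  have h1 : ∀ η, F ((2 * Real.pi) • η) = pdoIntegrand b s (spectral n s u) φ η := by
    intro η
    simp only [hF, pdoIntegrand]
    rw [fourierFun_smul, ampFourier_eq_integral_exp]
  have h2 : Integrable fun η => F ((2 * Real.pi) • η) := by
    simp only [h1]
    exact integrable_pdoIntegrand hb s _ φ
  refine ⟨(integrable_comp_smul_iff volume F hπ).1 h2, ?_⟩
  rw [pdoDist_apply]
  simp only [← h1]
  rw [Measure.integral_comp_smul]
  have : |(((2 * Real.pi) ^ Module.finrank ℝ (Eu n))⁻¹ : ℝ)| = ((2 * Real.pi) ^ n)⁻¹ := by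
    rw [abs_of_nonneg (by positivity)]; simp
  rw [this, Complex.real_smul]
  congr 1
  push_cast
  rw [zpow_neg, zpow_natCast]

/-- Multiplication by a Schwartz function on the space side is a convolution on the Fourier side:
here the shift by `η` is turned into a character, and `𝓕` is moved to the other factor. -/
theorem integral_fourier_sub_mul {c : Eu n → ℂ} (hc : Integrable c) (f : 𝓢(Eu n, ℂ)) (η : Eu n) :
    ∫ ζ, 𝓕 c (ζ - η) * (𝓕⁻ f) ζ = 𝓕 (fun x => c x * f x) (-η) := by
  let e : Eu n → ℂ := fun x => (Real.fourierChar (inner ℝ x η) : ℂ)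
  have he : Continuous e := by
    have : Continuous fun x : Eu n => inner ℝ x η := continuous_id.inner continuous_const
    exact continuous_subtype_val.comp (Real.continuous_fourierChar.comp this)
  have hec : Integrable fun x => e x * c x :=
    hc.bdd_mul he.aestronglyMeasurable (Eventually.of_forall fun x => (Circle.norm_coe _).le)
  have h1 : ∀ ζ, 𝓕 c (ζ - η) = 𝓕 (fun x => e x * c x) ζ := by
    intro ζ
    simp only [Real.fourier_eq]
    refine integral_congr_ae (Eventually.of_forall fun x => ?_)
    simp only [Circle.smul_def, smul_eq_mul, e, ← mul_assoc]
    rw [← Circle.coe_mul, ← AddChar.map_add_eq_mul, inner_sub_right]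
    congr 3
    ring
  have h2 := VectorFourier.integral_fourierIntegral_smul_eq_flip (L := innerₗ (Eu n))
    Real.continuous_fourierChar continuous_inner hec ((𝓕⁻ f).integrable (μ := volume))
  rw [flip_innerₗ] at h2
  calc ∫ ζ, 𝓕 c (ζ - η) * (𝓕⁻ f) ζ = ∫ ζ, 𝓕 (fun x => e x * c x) ζ * (𝓕⁻ f) ζ := by
        simp only [h1]
    _ = ∫ x, (e x * c x) * (𝓕 (𝓕⁻ f)) x := h2
    _ = ∫ x, (e x * c x) * f x := by rw [FourierTransform.fourier_fourierInv_eq]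
    _ = _ := by
        rw [Real.fourier_eq]
        refine integral_congr_ae (Eventually.of_forall fun x => ?_)
        simp only [Circle.smul_def, smul_eq_mul, e, inner_neg_right, neg_neg, mul_assoc]

/-- The localized operator `ψ b(x, D)`, seen on the Fourier side as an operator on `L²`. -/
theorem exists_cutOp {b : Eu n → Eu n → ℂ}
    (hb : ContDiffOn ℝ ∞ (fun y : Eu n × Eu n => b y.1 y.2) ((G : Set (Eu n)) ×ˢ Set.univ))
    (ψ : 𝓓(G, ℂ)) {l s M : ℝ} (hM0 : 0 ≤ M)
    (hM : SymbolLe (tsupport ψ) l (decayOrder n (s - l)) b M) {S : ℝ}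
    (hS : ∀ j ≤ decayOrder n (s - l), ∀ x, ‖iteratedFDeriv ℝ j ψ x‖ ≤ S) :
    ∃ R : L2 n →L[ℂ] L2 n,
      (∀ f, ‖R f‖ ≤ kernelConst n (tsupport ψ) l s * S * (∫ τ, decay n τ) * M * ‖f‖) ∧
      ∀ f g : L2 n, inner ℂ g (R f) = ∫ p : Eu n × Eu n,
        cutKernel b ψ (s - l) s p * (starRingEnd ℂ (g p.1) * f p.2) := by
  obtain ⟨R, h1, h2⟩ := exists_kernelOp
    (κ := fun τ => kernelConst n (tsupport ψ) l s * M * S * decay n τ)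
    (measurable_decay.const_mul _) (integrable_decay.const_mul _)
    (measurable_cutKernel hb ψ.contDiff ψ.tsupport_subset (s - l) s)
    (norm_cutKernel_le hb ψ.hasCompactSupport ψ.tsupport_subset hM0 hM ψ.contDiff subset_rfl hS)
  refine ⟨R, fun f => (h1 f).trans_eq ?_, h2⟩
  rw [integral_const_mul]
  ring

/-- The product of `Au` and a test function `ψ` is the element of `H^{s-l}` given by the localized
operator. -/
theorem isCutoff_pdoDist {l s : ℝ} {b : Eu n → Eu n → ℂ} (hb : IsLocalSymbol G l b)
    (ψ : 𝓓(G, ℂ)) {R : L2 n →L[ℂ] L2 n}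
    (hR : ∀ f g : L2 n, inner ℂ g (R f) = ∫ p : Eu n × Eu n,
        cutKernel b ψ (s - l) s p * (starRingEnd ℂ (g p.1) * f p.2)) (f : L2 n) :
    IsCutoff ψ (pdoDist hb s f) (Sob.toDist ((spectral n (s - l)).symm (R f))) := by
  intro θ
  have hg0 := SchwartzMap.smulLeftCLM_apply_apply (F := ℂ)
    (hasTemperateGrowth_bracket (n := n) (-(s - l))) (𝓕⁻ θ)
  set g0 : 𝓢(Eu n, ℂ) := SchwartzMap.smulLeftCLM ℂ
    (fun η : Eu n => ((bracket (-(s - l)) η : ℝ) : ℂ)) (𝓕⁻ θ)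
  have hgm : MemLp (fun ζ => starRingEnd ℂ (g0 ζ)) 2 (volume : Measure (Eu n)) :=
    (g0.memLp 2 volume).star
  set g : L2 n := hgm.toLp _
  have hg : g =ᵐ[volume] fun ζ => starRingEnd ℂ (g0 ζ) := hgm.coeFn_toLp
  obtain ⟨M, hM0, hM⟩ := hb.bound (decayOrder n (s - l)) (tsupport ψ) ψ.hasCompactSupport
    ψ.tsupport_subset
  obtain ⟨S, hS⟩ := exists_norm_iteratedFDeriv_le ψ (decayOrder n (s - l))
  have hg0' := (Measure.quasiMeasurePreserving_fst (μ := (volume : Measure (Eu n)))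
    (ν := (volume : Measure (Eu n)))).ae (g0.memLp 2 volume).coeFn_toLp
  have hg' := (Measure.quasiMeasurePreserving_fst (μ := (volume : Measure (Eu n)))
    (ν := (volume : Measure (Eu n)))).ae hg
  -- The two outer weights cancel.
  have hk : ∀ p : Eu n × Eu n, cutKernel b ψ (s - l) s p * (g0 p.1 * f p.2) =
      ampFourier b ψ (p.1 - p.2) ((2 * Real.pi) • p.2) * (𝓕⁻ θ) p.1 *
        (bracket (-s) p.2 * f p.2) := by
    intro p
    have h1 : ((bracket (-(s - l)) p.1 : ℝ) : ℂ) * (bracket (s - l) p.1 : ℝ) = 1 := by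
      exact_mod_cast bracket_neg_mul (s - l) p.1
    rw [hg0, cutKernel, smul_eq_mul]
    linear_combination (ampFourier b ψ (p.1 - p.2) ((2 * Real.pi) • p.2) * (𝓕⁻ θ) p.1 *
        (bracket (-s) p.2 * f p.2)) * h1
  have hint : Integrable (fun p : Eu n × Eu n =>
      ampFourier b ψ (p.1 - p.2) ((2 * Real.pi) • p.2) * (𝓕⁻ θ) p.1 *
        (bracket (-s) p.2 * f p.2)) := by
    refine (integrable_kernel (measurable_decay.const_mul _) (integrable_decay.const_mul _)
      (measurable_cutKernel hb.smooth ψ.contDiff ψ.tsupport_subset (s - l) s)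
      (norm_cutKernel_le hb.smooth ψ.hasCompactSupport ψ.tsupport_subset hM0 hM ψ.contDiff
        subset_rfl hS) f ((g0.memLp 2 volume).toLp _)).congr ?_
    filter_upwards [hg0'] with p hp
    rw [hp, hk]
  have hlhs : Sob.toDist ((spectral n (s - l)).symm (R f)) θ = inner ℂ g (R f) := by
    rw [toDist_apply, LinearIsometryEquiv.apply_symm_apply, L2.inner_def]
    refine integral_congr_ae ?_
    filter_upwards [hg] with ζ hζ
    rw [hζ, hg0]
    simp only [RCLike.inner_apply, smul_eq_mul, map_mul, Complex.conj_conj]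
    ring_nf
  rw [hlhs, hR, pdoDist_apply]
  calc ∫ p : Eu n × Eu n, cutKernel b ψ (s - l) s p * (starRingEnd ℂ (g p.1) * f p.2)
      = ∫ p : Eu n × Eu n, ampFourier b ψ (p.1 - p.2) ((2 * Real.pi) • p.2) * (𝓕⁻ θ) p.1 *
        (bracket (-s) p.2 * f p.2) := by
        refine integral_congr_ae ?_
        filter_upwards [hg'] with p hp
        rw [hp, Complex.conj_conj, hk]
    _ = ∫ η, ∫ ζ, ampFourier b ψ (ζ - η) ((2 * Real.pi) • η) * (𝓕⁻ θ) ζ *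
        (bracket (-s) η * f η) := integral_prod_symm _ hint
    _ = ∫ η, pdoIntegrand b s f (mulSchwartz ψ θ) η := by
        refine integral_congr_ae (Eventually.of_forall fun η => ?_)
        simp only
        rw [integral_mul_const]
        have h := integral_fourier_sub_mul
          (integrable_mul_testFunction hb.smooth ψ ((2 * Real.pi) • η)) θ η
        rw [pdoIntegrand, ampFourier]
        simp only [ampFourier, h, mul_assoc]
        rfl

end Operator

/-! ### The operator with values in the local Sobolev space -/

section Local

variable {n : ℕ} {G : Opens (Eu n)} {l s : ℝ}

/-- The operator `b(x, D) : H^s(ℝⁿ) → H^{s-l}_loc(G)`. -/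
def pdoLoc {b : Eu n → Eu n → ℂ} (hb : IsLocalSymbol G l b) : Sob n s →ₗ[ℂ] HLoc n (s - l) G where
  toFun u := ⟨pdoDist hb s (spectral n s u), fun ψ => by
    obtain ⟨M, hM0, hM⟩ := hb.bound (decayOrder n (s - l)) (tsupport ψ) ψ.hasCompactSupport
      ψ.tsupport_subset
    obtain ⟨S, hS⟩ := exists_norm_iteratedFDeriv_le ψ (decayOrder n (s - l))
    obtain ⟨R, -, hR⟩ := exists_cutOp hb.smooth ψ hM0 hM hS
    exact ⟨_, isCutoff_pdoDist hb ψ hR _⟩⟩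
  map_add' u v := by
    refine Subtype.ext (ContinuousLinearMap.ext fun φ => ?_)
    change pdoDist hb s _ φ = pdoDist hb s _ φ + pdoDist hb s _ φ
    simp only [pdoDist_apply]
    rw [← integral_add (integrable_pdoIntegrand hb s _ φ) (integrable_pdoIntegrand hb s _ φ)]
    refine integral_congr_ae ?_
    rw [map_add]
    filter_upwards [Lp.coeFn_add (spectral n s u) (spectral n s v)] with η hη
    rw [pdoIntegrand, hη, Pi.add_apply, mul_add, mul_add]
    rfl
  map_smul' c u := by
    refine Subtype.ext (ContinuousLinearMap.ext fun φ => ?_)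
    change pdoDist hb s _ φ = c * pdoDist hb s _ φ
    simp only [pdoDist_apply]
    rw [← integral_const_mul]
    refine integral_congr_ae ?_
    rw [map_smul]
    filter_upwards [Lp.coeFn_smul c (spectral n s u)] with η hη
    rw [pdoIntegrand, hη, Pi.smul_apply, smul_eq_mul, pdoIntegrand]
    ring

theorem cut_pdoLoc {b : Eu n → Eu n → ℂ} (hb : IsLocalSymbol G l b) (ψ : 𝓓(G, ℂ))
    {R : L2 n →L[ℂ] L2 n}
    (hR : ∀ f g : L2 n, inner ℂ g (R f) = ∫ p : Eu n × Eu n,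
        cutKernel b ψ (s - l) s p * (starRingEnd ℂ (g p.1) * f p.2)) (u : Sob n s) :
    HLoc.cut ψ (pdoLoc hb u) = (spectral n (s - l)).symm (R (spectral n s u)) :=
  HLoc.isCutoff_unique (HLoc.isCutoff_cut ψ (pdoLoc hb u)) (isCutoff_pdoDist hb ψ hR _)

/-- The norm of `u ↦ ψ b(x, D) u` is controlled by a seminorm of the symbol. -/
theorem exists_norm_cut_pdoLoc_le (s l : ℝ) (ψ : 𝓓(G, ℂ)) :
    ∃ C, 0 ≤ C ∧ ∀ {b : Eu n → Eu n → ℂ} (hb : IsLocalSymbol G l b) {M : ℝ}, 0 ≤ M →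
      SymbolLe (tsupport ψ) l (decayOrder n (s - l)) b M →
      ∀ u : Sob n s, ‖HLoc.cut ψ (pdoLoc hb u)‖ ≤ C * M * ‖u‖ := by
  obtain ⟨S, hS⟩ := exists_norm_iteratedFDeriv_le ψ (decayOrder n (s - l))
  have hS0 : 0 ≤ S := (norm_nonneg _).trans (hS 0 (Nat.zero_le _) 0)
  refine ⟨kernelConst n (tsupport ψ) l s * S * ∫ τ, decay n τ, mul_nonneg
    (mul_nonneg (kernelConst_nonneg _ _ _) hS0) (integral_nonneg decay_nonneg), ?_⟩
  intro b hb M hM0 hM u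
  obtain ⟨R, hRn, hR⟩ := exists_cutOp hb.smooth ψ hM0 hM hS
  rw [cut_pdoLoc hb ψ hR, LinearIsometryEquiv.norm_map]
  exact (hRn _).trans_eq (by rw [LinearIsometryEquiv.norm_map])

theorem stronglyMeasurable_cut_pdoLoc {Z : Type*} [MeasurableSpace Z] {b : Z → Eu n → Eu n → ℂ}
    (hb : ∀ z, IsLocalSymbol G l (b z))
    (hbm : ∀ x ∈ G, ∀ ξ, StronglyMeasurable fun z => b z x ξ) {u : Z → Sob n s}
    (hu : StronglyMeasurable u) (ψ : 𝓓(G, ℂ)) :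
    StronglyMeasurable fun z => HLoc.cut ψ (pdoLoc (hb z) (u z)) := by
  have hex : ∀ z, ∃ R : L2 n →L[ℂ] L2 n,
      ∀ f g : L2 n, inner ℂ g (R f) = ∫ p : Eu n × Eu n,
        cutKernel (b z) ψ (s - l) s p * (starRingEnd ℂ (g p.1) * f p.2) := by
    intro z
    obtain ⟨M, hM0, hM⟩ := (hb z).bound (decayOrder n (s - l)) (tsupport ψ) ψ.hasCompactSupport
      ψ.tsupport_subset
    obtain ⟨S, hS⟩ := exists_norm_iteratedFDeriv_le ψ (decayOrder n (s - l))
    obtain ⟨R, -, hR⟩ := exists_cutOp (hb z).smooth ψ hM0 hM hS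
    exact ⟨R, hR⟩
  choose R hR using hex
  simp only [fun z => cut_pdoLoc (hb z) ψ (hR z) (u z)]
  refine (spectral n (s - l)).symm.continuous.comp_stronglyMeasurable ?_
  have : Fact ((2 : ℝ≥0∞) ≠ ⊤) := ⟨by norm_num⟩
  refine stronglyMeasurable_clm_apply (fun f => stronglyMeasurable_of_inner fun g => ?_)
    ((spectral n s).continuous.comp_stronglyMeasurable hu)
  simp only [hR]
  have hk := stronglyMeasurable_cutKernel (fun z => (hb z).smooth) hbm ψ.contDiff
    ψ.tsupport_subset (s - l) s
  have hg := (Complex.continuous_conj.comp_stronglyMeasurable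
    (Lp.stronglyMeasurable g)).comp_measurable
    (measurable_fst.comp measurable_snd : Measurable fun q : Z × (Eu n × Eu n) => q.2.1)
  have hf := (Lp.stronglyMeasurable f).comp_measurable
    (measurable_snd.comp measurable_snd : Measurable fun q : Z × (Eu n × Eu n) => q.2.2)
  have h := hk.mul (hg.mul hf)
  exact StronglyMeasurable.integral_prod_right (ν := (volume : Measure (Eu n × Eu n)))
    (f := fun z p => cutKernel (b z) ψ (s - l) s p * (starRingEnd ℂ (g p.1) * f p.2)) h

end Local

/-! ### The operator on processes -/

section Stochastic

variable {Ω : Type*} {mΩ : MeasurableSpace Ω} {P : Measure Ω} {ℱ : Filtration ℝ≥0 mΩ} {T : ℝ}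
  {n : ℕ} {G : Opens (Eu n)} {p : ℝ≥0∞} {l s : ℝ} {a : Set.Icc (0 : ℝ) T × Ω → Eu n → Eu n → ℂ}

/-- The bounds on the derivatives in `x`, combined into one essentially bounded function of
`(t, ω)`. -/
theorem IsSymbol.exists_symbolLe (ha : IsSymbol G ℱ P l ⊤ a) (N : ℕ) {K : Set (Eu n)}
    (hK : IsCompact K) (hKG : K ⊆ G) :
    ∃ M : Set.Icc (0 : ℝ) T × Ω → ℝ, (∀ z, 0 ≤ M z) ∧
      (∃ c, 0 ≤ c ∧ ∀ᵐ z ∂timeMeasure T P, M z ≤ c) ∧ ∀ z, SymbolLe K l N (a z) (M z) := by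
  have h := fun j => ha.bound 0 j K hK hKG
  choose M _ hMp hM using h
  have hc : ∀ j, ∃ c, 0 ≤ c ∧ ∀ᵐ z ∂timeMeasure T P, |M j z| ≤ c := by
    intro j
    refine ⟨(eLpNormEssSup (M j) (timeMeasure T P)).toReal, ENNReal.toReal_nonneg, ?_⟩
    have h1 : eLpNormEssSup (M j) (timeMeasure T P) ≠ ⊤ := by
      have := (hMp j).eLpNorm_ne_top
      rwa [eLpNorm_exponent_top] at this
    filter_upwards [ae_le_eLpNormEssSup (f := M j) (μ := timeMeasure T P)] with z hz
    have := ENNReal.toReal_mono h1 hz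
    simpa using this
  choose c hc0 hc using hc
  refine ⟨fun z => ∑ j ∈ Finset.range (N + 1), |M j z|,
    fun z => Finset.sum_nonneg fun _ _ => abs_nonneg _,
    ⟨∑ j ∈ Finset.range (N + 1), c j, Finset.sum_nonneg fun j _ => hc0 j, ?_⟩, ?_⟩
  · filter_upwards [ae_all_iff.2 hc] with z hz
    exact Finset.sum_le_sum fun j _ => hz j
  · intro z j hj x hx ξ
    have h1 := hM j z x hx ξ
    rw [norm_iteratedFDeriv_zero, Nat.cast_zero, sub_zero] at h1
    refine h1.trans (mul_le_mul_of_nonneg_right ((le_abs_self _).trans ?_) (by positivity))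
    exact Finset.single_le_sum (f := fun j => |M j z|) (fun _ _ => abs_nonneg _)
      (Finset.mem_range.2 (Nat.lt_succ_of_le hj))

theorem IsSymbol.isLocalSymbol (ha : IsSymbol G ℱ P l ⊤ a) (z : Set.Icc (0 : ℝ) T × Ω) :
    IsLocalSymbol G l (a z) where
  smooth := ha.smooth z
  bound N _ hK hKG := by
    obtain ⟨M, hM0, -, hM⟩ := ha.exists_symbolLe N hK hKG
    exact ⟨M z, hM0 z, hM z⟩

theorem IsSymbol.exists_norm_cut_le (ha : IsSymbol G ℱ P l ⊤ a) (s : ℝ) (ψ : 𝓓(G, ℂ)) :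
    ∃ C, 0 ≤ C ∧ ∀ᵐ z ∂timeMeasure T P, ∀ u : Sob n s,
      ‖HLoc.cut ψ (pdoLoc (ha.isLocalSymbol z) u)‖ ≤ C * ‖u‖ := by
  obtain ⟨C, hC0, hC⟩ := exists_norm_cut_pdoLoc_le s l ψ
  obtain ⟨M, hM0, ⟨c, hc0, hc⟩, hM⟩ := ha.exists_symbolLe (decayOrder n (s - l))
    ψ.hasCompactSupport ψ.tsupport_subset
  refine ⟨C * c, mul_nonneg hC0 hc0, ?_⟩
  filter_upwards [hc] with z hz u
  refine (hC (ha.isLocalSymbol z) (hM0 z) (hM z) u).trans ?_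
  gcongr

theorem IsSymbol.isAdaptedProcess_cut (ha : IsSymbol G ℱ P l ⊤ a)
    {u : Set.Icc (0 : ℝ) T × Ω → Sob n s} (hu : IsAdaptedProcess ℱ u) (ψ : 𝓓(G, ℂ)) :
    IsAdaptedProcess ℱ fun z => HLoc.cut ψ (pdoLoc (ha.isLocalSymbol z) (u z)) := by
  refine ⟨stronglyMeasurable_cut_pdoLoc ha.isLocalSymbol
    (fun x hx ξ => (ha.adapted x hx ξ).1) hu.1 ψ, fun t => ?_⟩
  -- For fixed `t` the same measurability statement is used on `Ω` with the σ-algebra `𝓕_t`.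
  let _ : MeasurableSpace Ω := ℱ ⟨t.1, t.2.1⟩
  exact stronglyMeasurable_cut_pdoLoc (fun w => ha.isLocalSymbol (t, w))
    (fun x hx ξ => (ha.adapted x hx ξ).2 t) (hu.2 t) ψ

theorem IsSymbol.isLocProcess (ha : IsSymbol G ℱ P l ⊤ a)
    {u : Set.Icc (0 : ℝ) T × Ω → Sob n s} (hu : IsAdaptedProcess ℱ u)
    (hup : MemLp u p (timeMeasure T P)) :
    IsLocProcess ℱ P p fun z => pdoLoc (ha.isLocalSymbol z) (u z) := by
  intro ψ
  have h := ha.isAdaptedProcess_cut hu ψ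
  obtain ⟨C, -, hC⟩ := ha.exists_norm_cut_le s ψ
  exact ⟨h, hup.of_le_mul h.1.aestronglyMeasurable (hC.mono fun z hz => hz (u z))⟩

namespace LpComp

theorem exists_adapted (u : LpComp n s G ℱ P T p) :
    ∃ u₀ : Set.Icc (0 : ℝ) T × Ω → Sob n s,
      IsAdaptedProcess ℱ u₀ ∧ toLp u =ᵐ[timeMeasure T P] u₀ := by
  obtain ⟨_, _, _, hu, _⟩ := u.2
  exact hu

/-- A measurable adapted process in the class `u`. -/
def rep (u : LpComp n s G ℱ P T p) : Set.Icc (0 : ℝ) T × Ω → Sob n s := (exists_adapted u).choose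

theorem isAdaptedProcess_rep (u : LpComp n s G ℱ P T p) : IsAdaptedProcess ℱ (rep u) :=
  (exists_adapted u).choose_spec.1

theorem toLp_ae_eq_rep (u : LpComp n s G ℱ P T p) : toLp u =ᵐ[timeMeasure T P] rep u :=
  (exists_adapted u).choose_spec.2

theorem memLp_rep (u : LpComp n s G ℱ P T p) : MemLp (rep u) p (timeMeasure T P) :=
  (memLp_congr_ae (toLp_ae_eq_rep u)).1 (Lp.memLp (toLp u))

end LpComp

theorem LpLoc.mk_eq_mk {r : ℝ} {v w : ↥(locProcesses n r G ℱ P T p)}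
    (h : ∀ᵐ z ∂timeMeasure T P, v.1 z = w.1 z) : LpLoc.mk v = LpLoc.mk w := by
  refine (Submodule.Quotient.eq _).2 ?_
  change ∀ᵐ z ∂timeMeasure T P, (v - w).1 z = 0
  filter_upwards [h] with z hz
  exact sub_eq_zero.2 hz

/-- The process `A u` for a symbol `a`, built from an adapted representative of `u`. -/
def spdoProcess (ha : IsSymbol G ℱ P l ⊤ a) (u : LpComp n s G ℱ P T p) :
    ↥(locProcesses n (s - l) G ℱ P T p) :=
  ⟨fun z => pdoLoc (ha.isLocalSymbol z) (LpComp.rep u z),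
    ha.isLocProcess (LpComp.isAdaptedProcess_rep u) (LpComp.memLp_rep u)⟩

/-- The stochastic pseudo-differential operator with symbol `a`, as a linear map. -/
def spdo (ha : IsSymbol G ℱ P l ⊤ a) :
    LpComp n s G ℱ P T p →ₗ[ℂ] LpLoc n (s - l) G ℱ P T p where
  toFun u := LpLoc.mk (spdoProcess ha u)
  map_add' u v := by
    rw [← map_add]
    refine LpLoc.mk_eq_mk ?_
    have h := Lp.coeFn_add (LpComp.toLp u) (LpComp.toLp v)
    rw [← map_add] at h
    filter_upwards [h, LpComp.toLp_ae_eq_rep u, LpComp.toLp_ae_eq_rep v,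
      LpComp.toLp_ae_eq_rep (u + v)] with z h1 h2 h3 h4
    change pdoLoc (ha.isLocalSymbol z) (LpComp.rep (u + v) z) =
      pdoLoc (ha.isLocalSymbol z) (LpComp.rep u z) + pdoLoc (ha.isLocalSymbol z) (LpComp.rep v z)
    rw [← h4, h1, Pi.add_apply, h2, h3, map_add]
  map_smul' c u := by
    rw [RingHom.id_apply, ← map_smul]
    refine LpLoc.mk_eq_mk ?_
    have h := Lp.coeFn_smul c (LpComp.toLp u)
    rw [← map_smul] at h
    filter_upwards [h, LpComp.toLp_ae_eq_rep u, LpComp.toLp_ae_eq_rep (c • u)] with z h1 h2 h4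
    change pdoLoc (ha.isLocalSymbol z) (LpComp.rep (c • u) z) =
      c • pdoLoc (ha.isLocalSymbol z) (LpComp.rep u z)
    rw [← h4, h1, Pi.smul_apply, h2, map_smul]

theorem isSPDO_spdo (ha : IsSymbol G ℱ P l ⊤ a) :
    IsSPDO a (spdo ha : LpComp n s G ℱ P T p → LpLoc n (s - l) G ℱ P T p) := by
  refine fun u => ⟨spdoProcess ha u, rfl, ?_⟩
  filter_upwards [LpComp.toLp_ae_eq_rep u] with z hz
  rw [hz]
  exact isPDOValue_pdoDist (ha.isLocalSymbol z) (LpComp.rep u z)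

theorem exists_norm_cut_spdo_le (ha : IsSymbol G ℱ P l ⊤ a) (ψ : 𝓓(G, ℂ)) :
    ∃ C, ∀ u : LpComp n s G ℱ P T p, ‖LpLoc.cut ψ (spdo ha u)‖ ≤ C * ‖LpComp.toLp u‖ := by
  obtain ⟨C, hC0, hC⟩ := ha.exists_norm_cut_le s ψ
  refine ⟨C, fun u => Lp.norm_le_mul_norm_of_ae_le_mul ?_⟩
  have h : (LpLoc.cut ψ (spdo ha u) : Set.Icc (0 : ℝ) T × Ω → Sob n (s - l))
      =ᵐ[timeMeasure T P] fun z => HLoc.cut ψ ((spdoProcess ha u).1 z) :=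
    ((spdoProcess ha u).2 ψ).2.coeFn_toLp
  filter_upwards [h, hC, LpComp.toLp_ae_eq_rep u] with z h1 h2 h3
  rw [h1, h3]
  exact h2 _

/-- A linear map from `L^p_𝓕(0, T; H^s_comp(G))` to a normed space that is bounded for the norm of
`L^p([0, T] × Ω; H^s)` is continuous for the inductive limit topology. -/
theorem LpComp.continuous_of_bound [Fact (1 ≤ p)] {Y : Type*} [NormedAddCommGroup Y]
    [NormedSpace ℂ Y] (B : LpComp n s G ℱ P T p →ₗ[ℂ] Y) {C : ℝ}
    (hB : ∀ u, ‖B u‖ ≤ C * ‖LpComp.toLp u‖) : Continuous B := by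
  -- The topology induced by `B` is one of those whose infimum is the inductive limit topology.
  rw [continuous_iff_le_induced]
  refine sInf_le ⟨topologicalAddGroup_induced B, continuousSMul_induced B, ?_, ?_⟩
  · exact LocallyConvexSpace.induced (B.restrictScalars ℝ)
  · intro K hK hKG
    refine continuous_induced_rng.2 ?_
    exact AddMonoidHomClass.continuous_of_bound (B ∘ₗ LpComp.incl K hK hKG) C fun u => hB _

theorem continuous_spdo [Fact (1 ≤ p)] (ha : IsSymbol G ℱ P l ⊤ a) :
    Continuous (spdo ha : LpComp n s G ℱ P T p →ₗ[ℂ] LpLoc n (s - l) G ℱ P T p) := by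
  refine continuous_iInf_rng.2 fun ψ => continuous_induced_rng.2 ?_
  obtain ⟨C, hC⟩ := exists_norm_cut_spdo_le (p := p) (s := s) ha ψ
  exact LpComp.continuous_of_bound
    ((LpLoc.cut ψ : LpLoc n (s - l) G ℱ P T p →ₗ[ℂ] _) ∘ₗ spdo ha) hC

end Stochastic

end SPDO

end

theorem theorem2 {Ω : Type*} {mΩ : MeasurableSpace Ω} (P : Measure Ω) [IsProbabilityMeasure P]
    (ℱ : Filtration ℝ≥0 mΩ) (hℱ : ∀ N : Set Ω, P N = 0 → MeasurableSet[ℱ 0] N)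
    (T : ℝ) (hT : 0 < T) (n : ℕ) (hn : 0 < n)
    (G : Opens (EuclideanSpace ℝ (Fin n))) (hG : IsConnected (G : Set (EuclideanSpace ℝ (Fin n))))
    (p : ℝ≥0∞) [Fact (1 ≤ p)] (l s : ℝ)
    (a : Set.Icc (0 : ℝ) T × Ω → EuclideanSpace ℝ (Fin n) → EuclideanSpace ℝ (Fin n) → ℂ)
    (ha : SPDO.IsSymbol G ℱ P l ⊤ a) :
    ∃ A : SPDO.LpComp n s G ℱ P T p →L[ℂ] SPDO.LpLoc n (s - l) G ℱ P T p, SPDO.IsSPDO a A := by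
  exact ⟨⟨SPDO.spdo ha, SPDO.continuous_spdo ha⟩, SPDO.isSPDO_spdo ha⟩
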